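/- West's stack-sorting map $s$ acts on permutations, regarded as finite words of distinct positive integers: $s$ fixes the empty word, and $s(LnR)=s(L)\,s(R)\,n$ if $n$ is the largest entry of $LnR$. A permutation $\pi$ is \emph{uniquely sorted} if $|s^{-1}(\pi)|=1$. Let $\mathcal U_n(231,4132)$ be the set of uniquely sorted permutations of $\{1,\dots,n\}$ that avoid the patterns $231$ and $4132$, and let $C(x)=\frac{1-\sqrt{1-4x}}{2x}$ be the generating function of the Catalan numbers. Then $$\sum_{k\ge 0}|\mathcal U_{2k+1}(231,4132)|\,x^k=C(xC(x)).$$ Moreover, for every $k\ge 0$, $|\mathcal U_{2k+1}(231,4132)|$ equals the number of intervals, that is, of pairs $(\Lambda,\Lambda')$ with $\Lambda\le\Lambda'$, of the $k$-th Pallo comb poset. Its elements are the Dyck paths $\Lambda=UD^{\gamma_1}UD^{\gamma_2}\cdots UD^{\gamma_k}$ of semilength $k$. For $1\le j\le k$ let $\mathrm{lon}_j(\Lambda)$ be the smallest integer $t\ge 0$ with $\gamma_j+\gamma_{j+1}+\cdots+\gamma_{j+t}>t$; then $\Lambda\le\Lambda'$ means that $\mathrm{lon}_j(\Lambda)\le\mathrm{lon}_j(\Lambda')$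 for all $j\in\{1,\dots,k\}$, and that for every $j$ with $\mathrm{lon}_j(\Lambda)<\mathrm{lon}_j(\Lambda')$ one has $\mathrm{lon}_\ell(\Lambda)\le j-\ell-1$ for all $1\le\ell<j$. -/

import Mathlib

namespace UniquelySorted

/-- A permutation in the wide sense: a finite word over the positive integers without repeated
letters. -/
def IsPermWord (w : List ℕ) : Prop := w.Nodup ∧ ∀ a ∈ w, 0 < a

/-- The largest entry of a word (`0` for the empty word). -/
def maxEntry (w : List ℕ) : ℕ := w.foldr max 0

lemma maxEntry_mem : ∀ {w : List ℕ}, w ≠ [] → maxEntry w ∈ w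
  | [a], _ => by simp [maxEntry]
  | a :: b :: w, _ => by
    have ih : maxEntry (b :: w) ∈ b :: w := maxEntry_mem (by simp)
    rcases max_choice a (maxEntry (b :: w)) with h | h
    · have : maxEntry (a :: b :: w) = a := h
      simp [this]
    · have : maxEntry (a :: b :: w) = maxEntry (b :: w) := h
      rw [this]
      exact List.mem_cons_of_mem _ ih

/-- West's stack-sorting map: `s` fixes the empty word, and `s (L n R) = s L ++ s R ++ [n]`, where
`n` is the largest entry. -/
def stackSort (w : List ℕ) : List ℕ :=
  if w = [] then []
  else
    stackSort (w.take (w.idxOf (maxEntry w))) ++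
      stackSort (w.drop (w.idxOf (maxEntry w) + 1)) ++ [maxEntry w]
termination_by w.length
decreasing_by
  · rename_i h
    have := List.idxOf_lt_length_of_mem (maxEntry_mem h)
    rw [List.length_take]
    omega
  · rename_i h
    have := List.length_pos_of_ne_nil h
    rw [List.length_drop]
    omega

/-- The fertility of `w`: the number of permutations that the stack-sorting map sends to `w`. -/
noncomputable def fertility (w : List ℕ) : ℕ := {v : List ℕ | IsPermWord v ∧ stackSort v = w}.ncard

/-- `w` contains the pattern `t`: some subsequence of `w` has the same relative order as `t`. -/
def Contains (w t : List ℕ) : Prop :=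
  ∃ f : Fin t.length → Fin w.length, StrictMono f ∧
    ∀ a b, w.get (f a) < w.get (f b) ↔ t.get a < t.get b

/-- The set `S_n` of permutations of `{1, …, n}`, in one-line notation. -/
def permWords (n : ℕ) : Set (List ℕ) := {w | w.Perm (List.range' 1 n)}

/-- The set of uniquely sorted permutations in `S_n` that avoid every pattern in `T`. -/
def uniquelySortedAvoiding (n : ℕ) (T : Set (List ℕ)) : Set (List ℕ) :=
  {w | w ∈ permWords n ∧ fertility w = 1 ∧ ∀ t ∈ T, ¬ Contains w t}

/-- For a word `U D^γ₁ U D^γ₂ ⋯ U D^γₖ`, the list `[γ₁, …, γₖ]`. -/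
def downRuns : List DyckStep → List ℕ
  | [] => []
  | DyckStep.U :: w => (w.takeWhile (· = DyckStep.D)).length :: downRuns w
  | DyckStep.D :: w => downRuns w

/-- The longevity of the up step with index `j` (indices start at `0`): the smallest `t` such
that `γ_j + γ_{j+1} + ⋯ + γ_{j+t} > t`. For `j` less than the semilength such a `t` exists. -/
noncomputable def longevity (p : DyckWord) (j : ℕ) : ℕ :=
  sInf {t : ℕ | t < ∑ i ∈ Finset.range (t + 1), (downRuns p.toList).getD (j + i) 0}

/-- The set of Dyck paths of semilength `k`. -/
abbrev DyckPath (k : ℕ) : Type := {p : DyckWord // p.semilength = k}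

/-- The order of the Tamari lattice on Dyck paths of semilength `k`. -/
def TamariLE {k : ℕ} (p q : DyckPath k) : Prop :=
  ∀ j < k, longevity p.1 j ≤ longevity q.1 j

/-- The order of the Pallo comb poset on Dyck paths of semilength `k`. -/
def PalloLE {k : ℕ} (p q : DyckPath k) : Prop :=
  TamariLE p q ∧
    ∀ j < k, longevity p.1 j < longevity q.1 j → ∀ l < j, longevity p.1 l ≤ j - l - 1

/-- The intervals of the `k`-th Pallo comb poset: the pairs `(p, q)` with `p ≤ q`. -/
def PalloInterval (k : ℕ) : Type := {I : DyckPath k × DyckPath k // PalloLE I.1 I.2}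

/-- The generating function `C(x) = (1 - √(1 - 4x)) / (2x)` of the Catalan numbers, with integer
coefficients. -/
noncomputable def catalanGF : PowerSeries ℤ := PowerSeries.mk fun n => (catalan n : ℤ)

end UniquelySorted

namespace UniquelySorted

/-! ### Basic facts on the stack-sorting map -/

/-! Both families have generating function `U` with `U = 1 + x C(x) U²`, an equation with one power
series solution, `C(x C(x))` (`eq_pairGF`).

Permutations. Call a sorted word `w` tight if `2 * des w + 1 = w.length`. Splitting at the maximum
shows that a nonempty sorted word never has more descents than this, and that tight words are built
from tight words: one letter, or two tight words with a descent between them followed by a larger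
letter. A nonempty word is uniquely sorted iff it is sorted and tight (`fertility_eq_one_iff`): a
tight image can be cut in only one way, and without tightness a second preimage can be written down.
The recursive structure can be parsed left to right with a stack (`fertility_eq_one_iff_scan`). If
the word also avoids 231 and 4132, its first letter `f` is followed by all smaller letters and then
by all larger ones. The smaller ones avoid 231 and 132, so they form a valley, and the letters on
the stack are below everything still to come, so only their number `h` matters (`mem_words_iff`).
With `V = z C(z²)`, valleys that leave `c` extra letters on the stack are counted by `V^(c+1)`, and
words read from a stack of size `h` by `W^h`, where `W = z + V W²` (`card_valley`, `card_words`).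
Thus `W = z U(z²)`.

Intervals. The longevity of an up step is the number of up steps under its arch. If `p ≤ q` in the
Pallo order, nothing under the first arch of `p` can change, so `p = a.nest + b + c` and `q = (a +
b').nest + c'` with `b ≤ b'`, `c ≤ c'`, and `a` is arbitrary (`palloRel_glue`,
`PalloRel.exists_glue`). This decomposition gives the equation for `U`. -/

lemma le_maxEntry {w : List ℕ} {x : ℕ} (hx : x ∈ w) : x ≤ maxEntry w := by
  induction w with
  | nil => simp at hx
  | cons a w ih =>
    rcases List.mem_cons.1 hx with rfl | h
    · exact le_max_left _ _
    · exact (ih h).trans (le_max_right _ _)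

lemma maxEntry_append_cons {L R : List ℕ} {n : ℕ} (hL : ∀ x ∈ L, x < n) (hR : ∀ x ∈ R, x < n) :
    maxEntry (L ++ n :: R) = n := by
  apply le_antisymm
  · have := maxEntry_mem (w := L ++ n :: R) (by simp)
    rcases List.mem_append.1 this with h | h
    · exact (hL _ h).le
    · rcases List.mem_cons.1 h with h | h
      · exact h.le
      · exact (hR _ h).le
  · exact le_maxEntry (by simp)

@[simp] lemma stackSort_nil : stackSort [] = [] := by
  rw [stackSort]; simp

lemma stackSort_append_cons {L R : List ℕ} {n : ℕ} (hL : ∀ x ∈ L, x < n) (hR : ∀ x ∈ R, x < n) :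
    stackSort (L ++ n :: R) = stackSort L ++ stackSort R ++ [n] := by
  rw [stackSort, maxEntry_append_cons hL hR]
  have h1 : n ∉ L := fun h => lt_irrefl _ (hL n h)
  have h2 : (L ++ n :: R).idxOf n = L.length := by
    rw [List.idxOf_append_of_notMem h1]; simp
  rw [h2]
  simp

lemma exists_eq_append_max_cons {v : List ℕ} (hv : v.Nodup) (h0 : v ≠ []) :
    ∃ L n R, v = L ++ n :: R ∧ (∀ x ∈ L, x < n) ∧ ∀ x ∈ R, x < n := by
  obtain ⟨L, R, h⟩ := List.append_of_mem (maxEntry_mem h0)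
  refine ⟨L, maxEntry v, R, h, ?_, ?_⟩
  · intro x hx
    refine lt_of_le_of_ne (le_maxEntry (by rw [h]; simp [hx])) ?_
    rintro rfl
    rw [h] at hv
    simp [List.nodup_append] at hv
    exact (hv.2.2 _ hx).1 rfl
  · intro x hx
    refine lt_of_le_of_ne (le_maxEntry (by rw [h]; simp [hx])) ?_
    rintro rfl
    rw [h] at hv
    simp [List.nodup_append] at hv
    exact hv.2.1.1 hx

/-- Induction along the decomposition of a word at its largest letter. -/
lemma max_induction {P : List ℕ → Prop} (nil : P [])
    (node : ∀ L n R, (∀ x ∈ L, x < n) → (∀ x ∈ R, x < n) → (L ++ n :: R).Nodup → P L → P R →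
      P (L ++ n :: R)) : ∀ v : List ℕ, v.Nodup → P v := by
  suffices h : ∀ k, ∀ v : List ℕ, v.length = k → v.Nodup → P v from fun v => h _ v rfl
  intro k
  induction k using Nat.strong_induction_on with
  | _ k ih =>
    intro v hk hv
    rcases eq_or_ne v [] with rfl | h0
    · exact nil
    · obtain ⟨L, n, R, rfl, hL, hR⟩ := exists_eq_append_max_cons hv h0
      have hL' : L.Nodup := hv.sublist (by simp)
      have hR' : R.Nodup :=
        hv.sublist ((List.sublist_cons_self _ _).trans (List.sublist_append_right _ _))
      simp at hk
      exact node L n R hL hR hv (ih _ (by omega) L rfl hL') (ih _ (by omega) R rfl hR')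

lemma stackSort_perm_of_length : ∀ (k : ℕ) (v : List ℕ), v.length = k → (stackSort v).Perm v := by
  intro k
  induction k using Nat.strong_induction_on with
  | _ k ih =>
    intro v hk
    rcases eq_or_ne v [] with rfl | h0
    · simp
    · have h1 := List.idxOf_lt_length_of_mem (maxEntry_mem h0)
      rw [stackSort, if_neg h0]
      have a1 := ih _ (by rw [List.length_take]; omega)
        (v.take (v.idxOf (maxEntry v))) rfl
      have a2 := ih _ (by rw [List.length_drop]; omega)
        (v.drop (v.idxOf (maxEntry v) + 1)) rfl
      rw [List.append_assoc]
      have a3 := a1.append ((List.perm_append_singleton (maxEntry v) _).trans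
        (a2.cons (maxEntry v)))
      refine a3.trans ?_
      have : maxEntry v = v[v.idxOf (maxEntry v)] := by simp
      conv_lhs => enter [2, 1]; rw [this]
      rw [← List.drop_eq_getElem_cons, List.take_append_drop]

lemma stackSort_perm_self (v : List ℕ) : (stackSort v).Perm v := stackSort_perm_of_length _ v rfl

lemma stackSort_eq_nil {v : List ℕ} : stackSort v = [] ↔ v = [] := by
  have := (stackSort_perm_self v).length_eq
  rw [← List.length_eq_zero_iff, this, List.length_eq_zero_iff]

lemma fertility_eq {w : List ℕ} (hw : IsPermWord w) :
    fertility w = {v : List ℕ | stackSort v = w}.ncard := by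
  unfold fertility
  congr 1
  ext v
  simp only [Set.mem_ofPred_eq, and_iff_right_iff_imp]
  rintro rfl
  have := stackSort_perm_self v
  exact ⟨this.nodup_iff.1 hw.1, fun a ha => hw.2 a (this.mem_iff.2 ha)⟩

/-! ### Descents -/

/-- The number of descents across the junction of two words. -/
def junction (A B : List ℕ) : ℕ :=
  match A.getLast?, B.head? with
  | some a, some b => if b < a then 1 else 0
  | _, _ => 0

/-- The number of descents of a word. -/
def des : List ℕ → ℕ
  | [] => 0
  | a :: w => junction [a] w + des w

@[simp] lemma junction_nil_left (B : List ℕ) : junction [] B = 0 := by simp [junction]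

@[simp] lemma junction_nil_right (A : List ℕ) : junction A [] = 0 := by
  unfold junction; cases A.getLast? <;> simp

lemma junction_le_one (A B : List ℕ) : junction A B ≤ 1 := by
  unfold junction
  split
  · split_ifs <;> simp
  · simp

lemma junction_append_right {A M : List ℕ} (hM : M ≠ []) (N : List ℕ) :
    junction A (M ++ N) = junction A M := by
  cases M with
  | nil => simp at hM
  | cons m M => simp [junction]

lemma junction_cons_left {A : List ℕ} (hA : A ≠ []) (a : ℕ) (B : List ℕ) :
    junction (a :: A) B = junction A B := by
  cases A with
  | nil => simp at hA
  | cons m M => simp [junction, List.getLast?_cons_cons]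

lemma junction_eq_zero {A B : List ℕ} (h : ∀ x ∈ A, ∀ y ∈ B, x < y) : junction A B = 0 := by
  unfold junction
  split
  · rename_i a b ha hb
    have := h a (List.mem_of_getLast? ha) b (List.mem_of_head? hb)
    rw [if_neg (by omega)]
  · rfl

lemma junction_eq_one {A B : List ℕ} : junction A B = 1 ↔
    ∃ a b, A.getLast? = some a ∧ B.head? = some b ∧ b < a := by
  unfold junction
  split
  · rename_i a b ha hb
    simp [ha, hb]
  · rename_i h
    simp only [zero_ne_one, false_iff, not_exists, not_and]
    intro a b ha hb
    exact (h a b ha hb).elim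

lemma des_append (A B : List ℕ) : des (A ++ B) = des A + junction A B + des B := by
  induction A with
  | nil => simp [des]
  | cons a A ih =>
    simp only [List.cons_append, des, ih]
    rcases eq_or_ne A [] with rfl | h
    · simp [des]
    · rw [junction_append_right h, junction_cons_left h]; omega

lemma des_append_singleton {A : List ℕ} {n : ℕ} (h : ∀ x ∈ A, x < n) : des (A ++ [n]) = des A := by
  rw [des_append, junction_eq_zero (by simpa using h)]
  simp [des]

lemma mem_stackSort {v : List ℕ} {x : ℕ} : x ∈ stackSort v ↔ x ∈ v :=
  (stackSort_perm_self v).mem_iff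

lemma des_stackSort_append_cons {L R : List ℕ} {n : ℕ} (hL : ∀ x ∈ L, x < n)
    (hR : ∀ x ∈ R, x < n) : des (stackSort (L ++ n :: R)) =
      des (stackSort L) + junction (stackSort L) (stackSort R) + des (stackSort R) := by
  rw [stackSort_append_cons hL hR, des_append_singleton, des_append]
  intro x hx
  rcases List.mem_append.1 hx with h | h
  · exact hL x (mem_stackSort.1 h)
  · exact hR x (mem_stackSort.1 h)

/-- Splitting at the maximum costs one letter and at most one descent, at the junction, and that
descent needs both sides nonempty. -/
lemma des_stackSort_lt {v : List ℕ} (hv : v.Nodup) :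
    v ≠ [] → 2 * des (stackSort v) + 1 ≤ v.length := by
  revert v
  apply max_induction
  · simp
  · intro L n R hL hR _ ihL ihR _
    rw [des_stackSort_append_cons hL hR]
    have := junction_le_one (stackSort L) (stackSort R)
    rcases eq_or_ne L [] with rfl | h1 <;> rcases eq_or_ne R [] with rfl | h2
    · simp [des]
    · have := ihR h2; simp [des]; omega
    · have := ihL h1; simp [des]; omega
    · have := ihR h2; have := ihL h1; simp; omega

/-- A sorted word with as many descents as possible splits into two words of the same kind. -/
lemma tight_split {L R : List ℕ} {n : ℕ} (hL : ∀ x ∈ L, x < n) (hR : ∀ x ∈ R, x < n)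
    (hd : (L ++ n :: R).Nodup)
    (h : 2 * des (stackSort (L ++ n :: R)) + 1 = (L ++ n :: R).length) :
    (L = [] ∧ R = []) ∨ (L ≠ [] ∧ R ≠ [] ∧ 2 * des (stackSort L) + 1 = L.length ∧
      2 * des (stackSort R) + 1 = R.length ∧ junction (stackSort L) (stackSort R) = 1) := by
  rw [des_stackSort_append_cons hL hR] at h
  have hL' : L.Nodup := hd.sublist (by simp)
  have hR' : R.Nodup :=
    hd.sublist ((List.sublist_cons_self _ _).trans (List.sublist_append_right _ _))
  have hj := junction_le_one (stackSort L) (stackSort R)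
  rcases eq_or_ne L [] with rfl | h1 <;> rcases eq_or_ne R [] with rfl | h2
  · simp
  · have := des_stackSort_lt hR' h2; simp [des] at h; omega
  · have := des_stackSort_lt hL' h1; simp [des] at h; omega
  · have := des_stackSort_lt hR' h2; have := des_stackSort_lt hL' h1
    simp at h
    right
    refine ⟨h1, h2, ?_, ?_, ?_⟩ <;> omega

/-- Proper prefixes of a sorted word with as many descents as possible have many descents. -/
lemma prefix_length_le {v : List ℕ} (hv : v.Nodup) : 2 * des (stackSort v) + 1 = v.length →
    ∀ M N, stackSort v = M ++ N → N ≠ [] → M.length ≤ 2 * des M + 1 := by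
  revert v
  apply max_induction
  · simp
  · intro L n R hL hR hd ihL ihR h M N hMN hN
    have key := tight_split hL hR hd h
    rw [stackSort_append_cons hL hR] at hMN
    obtain ⟨N', x, rfl⟩ := List.eq_nil_or_concat'  N |>.resolve_left hN
    rw [← List.append_assoc] at hMN
    have hMN' := (List.append_inj' hMN rfl).1
    rcases key with ⟨rfl, rfl⟩ | ⟨h1, h2, h3, h4, h5⟩
    · simp at hMN'
      simp [hMN'.1]
    · have l1 := (stackSort_perm_self L).length_eq
      have l2 := (stackSort_perm_self R).length_eq
      -- The cut falls inside `stackSort R` or inside `stackSort L`. In the first case the junction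
      -- descent adds 2 to the bound, enough for the two pieces together.
      rcases List.append_eq_append_iff.1 hMN' with ⟨M2, hM, hR2⟩ | ⟨M2, hM, hR2⟩
      · rw [hM, des_append]
        rcases eq_or_ne M2 [] with rfl | hM2
        · simp [des]; omega
        · have hj : junction (stackSort L) M2 = 1 := by
            rw [← h5, hR2, junction_append_right hM2]
          rw [hj]
          rcases eq_or_ne N' [] with rfl | hN'
          · simp at hR2; simp [← hR2]; omega
          · have := ihR h4 M2 N' hR2 hN'
            simp; omega
      · rcases eq_or_ne M2 [] with rfl | hM2
        · simp at hM; rw [← hM]; omega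
        · exact ihL h3 M M2 hM hM2

/-! ### Unique sortedness in terms of descents -/

/-- If `L'` were longer, `stackSort L'` would be `stackSort L` followed by a nonempty proper prefix
`M` of `stackSort R`. The junction descent together with `M.length ≤ 2 * des M + 1` would give it
more descents than tightness allows. -/
lemma stackSort_splits_unique {L R L' R' : List ℕ} (hR : R.Nodup) (h0 : R' ≠ [])
    (tL : 2 * des (stackSort L) + 1 = L.length) (tR : 2 * des (stackSort R) + 1 = R.length)
    (tL' : 2 * des (stackSort L') + 1 = L'.length)
    (j : junction (stackSort L) (stackSort R) = 1)
    (h : stackSort L ++ stackSort R = stackSort L' ++ stackSort R') :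
    L'.length ≤ L.length := by
  by_contra! hlt
  have l1 := (stackSort_perm_self L).length_eq
  have l2 := (stackSort_perm_self L').length_eq
  rcases List.append_eq_append_iff.1 h with ⟨M, h1, h2⟩ | ⟨M, h1, h2⟩
  · have hM : M ≠ [] := by
      rintro rfl
      simp at h1
      rw [h1] at l2; omega
    have p := prefix_length_le hR tR M _ h2 (by rwa [Ne, stackSort_eq_nil])
    have e := des_append (stackSort L) M
    rw [← h1] at e
    rw [h2, junction_append_right hM] at j
    have := congrArg List.length h1
    rw [List.length_append] at this
    omega
  · have := congrArg List.length h1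
    rw [List.length_append] at this
    omega

/-- A word with the same image is tight too. The two splittings bound each other's lengths, so they
cut the image at the same place and induction applies to both sides. -/
lemma stackSort_inj_of_tight {v : List ℕ} (hv : v.Nodup) :
    2 * des (stackSort v) + 1 = v.length → ∀ v', stackSort v' = stackSort v → v' = v := by
  revert v
  apply max_induction
  · simp
  · intro L n R hL hR hd ihL ihR h v' hv'
    have hp := (stackSort_perm_self v').symm.trans ((hv' ▸ stackSort_perm_self (L ++ n :: R)))
    have hd' : v'.Nodup := hp.nodup_iff.2 hd
    have h0' : v' ≠ [] := by
      rintro rfl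
      simpa using hp.length_eq
    obtain ⟨L', n', R', rfl, hL', hR'⟩ := exists_eq_append_max_cons hd' h0'
    have h' : 2 * des (stackSort (L' ++ n' :: R')) + 1 = (L' ++ n' :: R').length := by
      rw [hv', h, hp.length_eq]
    have a := tight_split hL hR hd h
    have a' := tight_split hL' hR' hd' h'
    have e := hv'
    rw [stackSort_append_cons hL hR, stackSort_append_cons hL' hR'] at e
    obtain ⟨e1, e2⟩ := List.append_inj' e rfl
    simp at e2
    subst e2
    rcases a with ⟨rfl, rfl⟩ | ⟨b1, b2, b3, b4, b5⟩
    · simp [stackSort_eq_nil] at e1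
      simp [e1]
    · rcases a' with ⟨rfl, rfl⟩ | ⟨c1, c2, c3, c4, c5⟩
      · simp [stackSort_eq_nil] at e1
        exact (b1 e1.1).elim
      · have f (A B : List ℕ) (m : ℕ) (hd : (A ++ m :: B).Nodup) : A.Nodup ∧ B.Nodup :=
          ⟨hd.sublist (by simp),
            hd.sublist ((List.sublist_cons_self _ _).trans (List.sublist_append_right _ _))⟩
        obtain ⟨d1, d2⟩ := f _ _ _ hd
        obtain ⟨d3, d4⟩ := f _ _ _ hd'
        have g1 := stackSort_splits_unique d2 c2 b3 b4 c3 b5 e1.symm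
        have g2 := stackSort_splits_unique d4 b2 c3 c4 b3 c5 e1
        have l1 := (stackSort_perm_self L).length_eq
        have l2 := (stackSort_perm_self L').length_eq
        obtain ⟨i1, i2⟩ := List.append_inj e1 (by omega)
        rw [ihL b3 L' i1, ihR b4 R' i2]

/-- If the first letter of `stackSort R` exceeds all letters of `L`, then
`stackSort L ++ stackSort R` is sorted. -/
lemma exists_stackSort_eq_append {L : List ℕ} {R : List ℕ} (hR : R.Nodup) :
    ∀ b, (stackSort R).head? = some b → (∀ x ∈ L, x < b) →
      ∃ X, stackSort X = stackSort L ++ stackSort R := by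
  revert R
  apply max_induction
  · simp
  · intro R₁ m R₂ h1 h2 hd ih1 ih2 b hb hL
    have hbm : b ≤ m := by
      have : b ∈ R₁ ++ m :: R₂ := mem_stackSort.1 (List.mem_of_head? hb)
      rcases List.mem_append.1 this with h | h
      · exact (h1 _ h).le
      · rcases List.mem_cons.1 h with h | h
        · exact h.le
        · exact (h2 _ h).le
    have hLm : ∀ x ∈ L, x < m := fun x hx => (hL x hx).trans_le hbm
    have mem_X {X S : List ℕ} (hX : stackSort X = stackSort L ++ stackSort S)
        (hS : ∀ x ∈ S, x < m) : ∀ x ∈ X, x < m := by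
      intro x hx
      rw [← mem_stackSort, hX, List.mem_append, mem_stackSort, mem_stackSort] at hx
      exact hx.elim (hLm x) (hS x)
    rw [stackSort_append_cons h1 h2] at hb ⊢
    -- The first letter of `stackSort R` comes from the leftmost leaf of the decomposition tree of
    -- `R`; `L` is grafted there as a left subtree.
    rcases eq_or_ne R₁ [] with rfl | hR1
    · rcases eq_or_ne R₂ [] with rfl | hR2
      · exact ⟨L ++ [m], by rw [stackSort_append_cons hLm (by simp)]; simp⟩
      · have hb' : (stackSort R₂).head? = some b := by
          rw [← stackSort_eq_nil.ne] at hR2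
          revert hb
          cases h : stackSort R₂ with
          | nil => exact (hR2 h).elim
          | cons => simp
        obtain ⟨X, hX⟩ := ih2 b hb' hL
        refine ⟨X ++ [m], ?_⟩
        rw [stackSort_append_cons (mem_X hX h2) (by simp), hX]
        simp
    · have hb' : (stackSort R₁).head? = some b := by
        rw [← stackSort_eq_nil.ne] at hR1
        revert hb
        cases h : stackSort R₁ with
        | nil => exact (hR1 h).elim
        | cons => simp
      obtain ⟨X, hX⟩ := ih1 b hb' hL
      refine ⟨X ++ m :: R₂, ?_⟩
      rw [stackSort_append_cons (mem_X hX h1) h2, hX]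
      simp

/-- The last letter of a sorted word is its maximum. -/
lemma le_getLast_stackSort {v : List ℕ} (hv : v.Nodup) {a x : ℕ}
    (ha : (stackSort v).getLast? = some a) (hx : x ∈ v) : x ≤ a := by
  obtain ⟨L, n, R, rfl, hL, hR⟩ := exists_eq_append_max_cons hv (by rintro rfl; simp at hx)
  rw [stackSort_append_cons hL hR] at ha
  simp at ha
  subst ha
  rcases List.mem_append.1 hx with h | h
  · exact (hL _ h).le
  · rcases List.mem_cons.1 h with h | h
    · exact h.le
    · exact (hR _ h).le

/-- Tightness fails in one of three ways. A nonempty side is not tight: induct. Exactly one side is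
empty: move the other across `n`. Both sides are tight but their images meet in an ascent: as the
last letter of `stackSort L` is the maximum of `L`, the word `stackSort L ++ stackSort R` is itself
sorted, so everything can be placed to the left of `n`. -/
lemma exists_ne_of_not_tight {v : List ℕ} (hv : v.Nodup) :
    v ≠ [] → 2 * des (stackSort v) + 1 ≠ v.length → ∃ v', v' ≠ v ∧ stackSort v' = stackSort v := by
  revert v
  apply max_induction
  · simp
  · intro L n R hL hR hd ihL ihR _ ht
    rw [des_stackSort_append_cons hL hR] at ht
    have hL' : L.Nodup := hd.sublist (by simp)
    have hR' : R.Nodup :=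
      hd.sublist ((List.sublist_cons_self _ _).trans (List.sublist_append_right _ _))
    rw [stackSort_append_cons hL hR]
    have lt_of {X S : List ℕ} (hX : stackSort X = stackSort S) (hS : ∀ x ∈ S, x < n) :
        ∀ x ∈ X, x < n := by
      intro x hx
      rw [← mem_stackSort, hX, mem_stackSort] at hx
      exact hS x hx
    by_cases tL : L ≠ [] ∧ 2 * des (stackSort L) + 1 ≠ L.length
    · obtain ⟨X, hX, hX'⟩ := ihL tL.1 tL.2
      refine ⟨X ++ n :: R, ?_, ?_⟩
      · simpa using hX
      · rw [stackSort_append_cons (lt_of hX' hL) hR, hX']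
    by_cases tR : R ≠ [] ∧ 2 * des (stackSort R) + 1 ≠ R.length
    · obtain ⟨X, hX, hX'⟩ := ihR tR.1 tR.2
      refine ⟨L ++ n :: X, ?_, ?_⟩
      · simpa using hX
      · rw [stackSort_append_cons hL (lt_of hX' hR), hX']
    rcases eq_or_ne L [] with rfl | h1 <;> rcases eq_or_ne R [] with rfl | h2
    · simp [des] at ht
    · refine ⟨R ++ [n], ?_, ?_⟩
      · intro h
        cases R with
        | nil => simp at h2
        | cons r R =>
          simp at h
          have := hR r (by simp)
          omega
      · rw [stackSort_append_cons hR (by simp)]; simp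
    · refine ⟨n :: L, ?_, ?_⟩
      · intro h
        cases L with
        | nil => simp at h1
        | cons r R =>
          simp at h
          have := hL r (by simp)
          omega
      · have := stackSort_append_cons (L := []) (by simp) hL
        simpa using this
    · push Not at tL tR
      have tL := tL h1
      have tR := tR h2
      have hj : junction (stackSort L) (stackSort R) ≠ 1 := by
        intro hj
        rw [hj] at ht
        simp at ht
        omega
      have h1' := stackSort_eq_nil.ne.2 h1
      have h2' := stackSort_eq_nil.ne.2 h2
      obtain ⟨a, ha⟩ : ∃ a, (stackSort L).getLast? = some a := by
        rw [← Option.isSome_iff_exists]; simpa using h1'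
      obtain ⟨b, hb⟩ : ∃ b, (stackSort R).head? = some b := by
        rw [← Option.isSome_iff_exists]; simpa using h2'
      have hab : ¬ b < a := fun h => hj (junction_eq_one.2 ⟨a, b, ha, hb, h⟩)
      have hne : a ≠ b := by
        have m1 := mem_stackSort.1 (List.mem_of_getLast? ha)
        have m2 := mem_stackSort.1 (List.mem_of_head? hb)
        rintro rfl
        have := List.nodup_append.1 hd
        exact this.2.2 a m1 a (by simp [m2]) rfl
      obtain ⟨X, hX⟩ := exists_stackSort_eq_append (L := L) hR' b hb (fun x hx =>
        (le_getLast_stackSort hL' ha hx).trans_lt (by omega))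
      refine ⟨X ++ [n], ?_, ?_⟩
      · intro h
        have h3 := congrArg List.getLast? h
        cases R using List.reverseRecOn with
        | nil => simp at h2
        | append_singleton R r =>
          have h4 := hR r (by simp)
          have h5 : L ++ n :: (R ++ [r]) = (L ++ n :: R) ++ [r] := by simp
          rw [h5, List.getLast?_concat, List.getLast?_concat] at h3
          simp at h3
          omega
      · rw [stackSort_append_cons (fun x hx => ?_) (by simp), hX]
        · simp
        · rw [← mem_stackSort, hX, List.mem_append, mem_stackSort, mem_stackSort] at hx
          exact hx.elim (hL x) (hR x)

theorem fertility_eq_one_iff {w : List ℕ} (hw : IsPermWord w) (h0 : w ≠ []) :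
    fertility w = 1 ↔ (∃ v, stackSort v = w) ∧ 2 * des w + 1 = w.length := by
  rw [fertility_eq hw, Set.ncard_eq_one]
  constructor
  · rintro ⟨v, hv⟩
    have hvw : stackSort v = w := by
      have : v ∈ ({v} : Set (List ℕ)) := rfl
      rwa [← hv] at this
    refine ⟨⟨v, hvw⟩, ?_⟩
    by_contra h
    have hp := stackSort_perm_self v
    subst hvw
    obtain ⟨v', h1, h2⟩ := exists_ne_of_not_tight (hp.nodup_iff.1 hw.1)
      (stackSort_eq_nil.ne.1 h0) (by rwa [← hp.length_eq])
    have : v' ∈ ({v} : Set (List ℕ)) := by rw [← hv]; exact h2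
    exact h1 this
  · rintro ⟨⟨v, rfl⟩, h⟩
    have hp := stackSort_perm_self v
    refine ⟨v, ?_⟩
    ext v'
    simp only [Set.mem_ofPred_eq, Set.mem_singleton_iff]
    exact ⟨stackSort_inj_of_tight (hp.nodup_iff.1 hw.1) (by rw [h, hp.length_eq]) v',
      fun h => by rw [h]⟩

/-! ### A one-pass criterion with a stack of descent tops -/

/-- Reads a word with previous letter `p` and stack `st`: a descent pushes the descent top, an
ascent pops a descent top, which must be smaller than the ascent top. -/
def Scan : ℕ → List ℕ → List ℕ → Prop
  | _, st, [] => st = []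
  | p, st, x :: r => if x < p then Scan x (p :: st) r else
      match st with
      | [] => False
      | t :: st' => t < x ∧ Scan x st' r

lemma scan_cons_of_lt {p x : ℕ} {st r : List ℕ} (h : x < p) :
    Scan p st (x :: r) ↔ Scan x (p :: st) r := by rw [Scan.eq_def]; simp [h]

lemma scan_cons_nil {p x : ℕ} {r : List ℕ} (h : p ≤ x) : ¬ Scan p [] (x :: r) := by
  rw [Scan.eq_def]; simp [h.not_gt]

lemma scan_cons_cons {p x t : ℕ} {st r : List ℕ} (h : p ≤ x) :
    Scan p (t :: st) (x :: r) ↔ t < x ∧ Scan x st r := by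
  rw [Scan.eq_def]; simp [h.not_gt]

/-- A tight sorted word sends the scan to its last letter, with the stack unchanged. -/
lemma scan_stackSort {v : List ℕ} (hv : v.Nodup) : v ≠ [] →
    2 * des (stackSort v) + 1 = v.length → ∃ x r y, stackSort v = x :: r ∧
      (stackSort v).getLast? = some y ∧ ∀ st T, Scan x st (r ++ T) ↔ Scan y st T := by
  revert v
  apply max_induction
  · simp
  · intro L n R hL hR hd ihL ihR _ h
    rw [stackSort_append_cons hL hR]
    rcases tight_split hL hR hd h with ⟨rfl, rfl⟩ | ⟨h1, h2, h3, h4, h5⟩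
    · exact ⟨n, [], n, by simp⟩
    · obtain ⟨x, r, y, e1, e2, e3⟩ := ihL h1 h3
      obtain ⟨x', r', y', e1', e2', e3'⟩ := ihR h2 h4
      obtain ⟨a, b, ha, hb, hab⟩ := junction_eq_one.1 h5
      rw [e2] at ha
      rw [e1'] at hb
      simp at ha hb
      subst ha hb
      refine ⟨x, r ++ (x' :: r') ++ [n], n, by simp [e1, e1'], by simp, fun st T => ?_⟩
      have m1 := hL y (mem_stackSort.1 (List.mem_of_getLast? e2))
      have m2 := hR y' (mem_stackSort.1 (List.mem_of_getLast? e2'))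
      rw [List.append_assoc, List.append_assoc, e3, List.cons_append, scan_cons_of_lt hab, e3',
        List.cons_append, scan_cons_cons m2.le]
      simp [m1]

/-- A tight sorted word with last letter `p`. -/
def IsBlock (w : List ℕ) (p : ℕ) : Prop :=
  (∃ v, stackSort v = w) ∧ 2 * des w + 1 = w.length ∧ w.getLast? = some p ∧ ∀ x ∈ w, x ≤ p

lemma isBlock_singleton (p : ℕ) : IsBlock [p] p :=
  ⟨⟨[p], by simpa using stackSort_append_cons (L := []) (R := []) (n := p) (by simp) (by simp)⟩,
    by simp [des], by simp, by simp⟩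

lemma IsBlock.append {A B : List ℕ} {a b x : ℕ} (hA : IsBlock A a) (hB : IsBlock B b)
    (hab : junction A B = 1) (ha : a < x) (hb : b < x) : IsBlock (A ++ B ++ [x]) x := by
  obtain ⟨⟨L, rfl⟩, d1, l1, m1⟩ := hA
  obtain ⟨⟨R, rfl⟩, d2, l2, m2⟩ := hB
  have hL : ∀ y ∈ L, y < x := fun y hy => (m1 y (mem_stackSort.2 hy)).trans_lt ha
  have hR : ∀ y ∈ R, y < x := fun y hy => (m2 y (mem_stackSort.2 hy)).trans_lt hb
  refine ⟨⟨L ++ x :: R, stackSort_append_cons hL hR⟩, ?_, by simp, ?_⟩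
  · rw [← stackSort_append_cons hL hR, des_stackSort_append_cons hL hR, hab,
      stackSort_append_cons hL hR]
    simp; omega
  · intro y hy
    simp only [List.mem_append, mem_stackSort, List.mem_singleton] at hy
    rcases hy with (h | h) | h
    · exact (hL y h).le
    · exact (hR y h).le
    · exact h.le

/-- The word `u` is a concatenation of blocks with descents between them; `p` is its last letter
and `st` the stack of the last letters of the earlier blocks. -/
inductive Build : List ℕ → ℕ → List ℕ → Prop
  | base {cur : List ℕ} {p : ℕ} : IsBlock cur p → Build cur p []
  | push {u cur st : List ℕ} {t p : ℕ} : Build u t st → IsBlock cur p → junction u cur = 1 →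
      Build (u ++ cur) p (t :: st)

lemma Build.getLast? {u st : List ℕ} {p : ℕ} (h : Build u p st) : u.getLast? = some p := by
  cases h with
  | base h => exact h.2.2.1
  | push _ h _ => simp [List.getLast?_append, h.2.2.1]

lemma IsBlock.ne_nil {u : List ℕ} {p : ℕ} (h : IsBlock u p) : u ≠ [] := by
  rintro rfl
  simpa using h.2.2.1

/-- The scan is a shift-reduce parser. A descent opens a new one-letter block; an ascent to `x`
merges the last two blocks under `x`, where the popped letter and `p` are the block maxima that `x`
must exceed. -/
lemma Build.isBlock_of_scan {r : List ℕ} : ∀ {u st : List ℕ} {p : ℕ}, Build u p st →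
    (u ++ r).Nodup → Scan p st r → ∃ q, IsBlock (u ++ r) q := by
  induction r with
  | nil =>
    intro u st p hu _ h
    have : st = [] := by rw [Scan.eq_def] at h; exact h
    subst this
    cases hu with
    | base h => exact ⟨p, by simpa using h⟩
  | cons x r ih =>
    intro u st p hu hd h
    have hne : x ≠ p := by
      rintro rfl
      exact (List.nodup_append.1 hd).2.2 x (List.mem_of_getLast? hu.getLast?) x (by simp) rfl
    have e : u ++ x :: r = (u ++ [x]) ++ r := by simp
    rw [e] at hd ⊢
    by_cases hx : x < p
    · rw [scan_cons_of_lt hx] at h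
      refine ih (Build.push hu (isBlock_singleton x) ?_) hd h
      exact junction_eq_one.2 ⟨p, x, hu.getLast?, rfl, hx⟩
    · cases hu with
      | base hb => exact (scan_cons_nil (by omega) h).elim
      | push hu hb hj =>
        rename_i u cur st t
        rw [scan_cons_cons (by omega)] at h
        refine ih ?_ hd h.2
        cases hu with
        | base hb' => exact Build.base (hb'.append hb hj h.1 (by omega))
        | push hu2 hb2 hj2 =>
          rename_i u2 cur2 st2 t2
          have hj' : junction cur2 cur = 1 := by
            rw [junction_eq_one] at hj ⊢
            rw [List.getLast?_append_of_ne_nil _ hb2.ne_nil] at hj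
            exact hj
          have e2 : u2 ++ cur2 ++ cur ++ [x] = u2 ++ (cur2 ++ cur ++ [x]) := by simp
          rw [e2]
          refine Build.push hu2 (hb2.append hb hj' h.1 (by omega)) ?_
          rw [List.append_assoc, junction_append_right hb2.ne_nil, hj2]

/-- The start `Scan 0 [0]` makes the first letter an ascent that pops the dummy `0`, so that the
remaining word is read from an empty stack. -/
theorem fertility_eq_one_iff_scan {w : List ℕ} (hw : IsPermWord w) (h0 : w ≠ []) :
    fertility w = 1 ↔ Scan 0 [0] w := by
  rw [fertility_eq_one_iff hw h0]
  cases w with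
  | nil => simp at h0
  | cons x r =>
    have hx : 0 < x := hw.2 x (by simp)
    rw [scan_cons_cons hx.le]
    simp only [hx, true_and]
    constructor
    · rintro ⟨⟨v, hv⟩, h⟩
      have hp := stackSort_perm_self v
      have hd : v.Nodup := hp.nodup_iff.1 (hv ▸ hw.1)
      have hv0 : v ≠ [] := by rintro rfl; simp at hv
      obtain ⟨x', r', y, e1, e2, e3⟩ := scan_stackSort hd hv0 (by rw [← hp.length_eq, hv, h])
      rw [hv] at e1
      simp at e1
      obtain ⟨rfl, rfl⟩ := e1
      have := e3 [] []
      rw [List.append_nil] at this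
      rw [this]
      rw [Scan.eq_def]
    · intro h
      obtain ⟨q, hq⟩ := (Build.base (isBlock_singleton x)).isBlock_of_scan (r := r)
        (by simpa using hw.1) h
      exact ⟨hq.1, hq.2.1⟩

end UniquelySorted

namespace UniquelySorted
open List

/-! ### Pattern avoidance through sublists -/

lemma contains_iff {w t : List ℕ} : Contains w t ↔ ∃ u, u <+ w ∧ ∃ h : u.length = t.length,
    ∀ i j : Fin t.length, u.get (i.cast h.symm) < u.get (j.cast h.symm) ↔ t.get i < t.get j := by
  constructor
  · rintro ⟨f, hf, h⟩
    refine ⟨List.ofFn fun i => w.get (f i), ?_, by simp, fun i j => ?_⟩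
    · rw [List.sublist_iff_exists_fin_orderEmbedding_get_eq]
      refine ⟨OrderEmbedding.ofStrictMono (fun i => f (i.cast (by simp))) ?_, fun i => by simp; rfl⟩
      exact fun i j hij => hf (show (i : ℕ) < j from hij)
    · simpa using h i j
  · rintro ⟨u, hu, hl, h⟩
    obtain ⟨f, hf⟩ := List.sublist_iff_exists_fin_orderEmbedding_get_eq.1 hu
    refine ⟨fun i => f (i.cast hl.symm), fun i j hij => f.strictMono
      (show (i : ℕ) < j from hij), fun i j => ?_⟩
    rw [← h, hf, hf]

/-- Avoidance of 231. -/
def Avoids231 (l : List ℕ) : Prop := ∀ x y z, [x, y, z] <+ l → ¬ (z < x ∧ x < y)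

/-- Avoidance of 132. -/
def Avoids132 (l : List ℕ) : Prop := ∀ x y z, [x, y, z] <+ l → ¬ (x < z ∧ z < y)

/-- Avoidance of 4132. -/
def Avoids4132 (l : List ℕ) : Prop :=
  ∀ w x y z, [w, x, y, z] <+ l → ¬ (x < z ∧ z < y ∧ y < w)

lemma not_contains_231_iff {w : List ℕ} : ¬ Contains w [2, 3, 1] ↔ Avoids231 w := by
  rw [contains_iff]
  constructor
  · intro h x y z hs hc
    refine h ⟨_, hs, by simp, ?_⟩
    intro i j
    fin_cases i <;> fin_cases j <;> simp <;> omega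
  · rintro h ⟨u, hu, hl, hc⟩
    match u, hl with
    | [x, y, z], _ =>
      have h1 := hc 2 0
      have h2 := hc 0 1
      simp at h1 h2
      exact h x y z hu ⟨h1, h2⟩

lemma not_contains_4132_iff {w : List ℕ} : ¬ Contains w [4, 1, 3, 2] ↔ Avoids4132 w := by
  rw [contains_iff]
  constructor
  · intro h v x y z hs hc
    refine h ⟨_, hs, by simp, ?_⟩
    intro i j
    fin_cases i <;> fin_cases j <;> simp <;> omega
  · rintro h ⟨u, hu, hl, hc⟩
    match u, hl with
    | [v, x, y, z], _ =>
      have h1 := hc 1 3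
      have h2 := hc 3 2
      have h3 := hc 2 0
      simp at h1 h2 h3
      exact h v x y z hu ⟨h1, h2, h3⟩

lemma cons_sublist_cons_iff {x f : ℕ} {u r : List ℕ} :
    x :: u <+ f :: r ↔ x :: u <+ r ∨ (x = f ∧ u <+ r) := by
  constructor
  · intro h
    cases h with
    | cons _ h => exact Or.inl h
    | cons_cons _ h => exact Or.inr ⟨rfl, h⟩
  · rintro (h | ⟨rfl, h⟩)
    · exact h.cons _
    · exact h.cons_cons _

lemma Avoids231.sublist {l m : List ℕ} (h : Avoids231 m) (hs : l <+ m) : Avoids231 l :=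
  fun x y z h' => h x y z (h'.trans hs)

lemma Avoids132.sublist {l m : List ℕ} (h : Avoids132 m) (hs : l <+ m) : Avoids132 l :=
  fun x y z h' => h x y z (h'.trans hs)

lemma Avoids4132.sublist {l m : List ℕ} (h : Avoids4132 m) (hs : l <+ m) : Avoids4132 l :=
  fun w x y z h' => h w x y z (h'.trans hs)

lemma Avoids132.avoids4132 {l : List ℕ} (h : Avoids132 l) : Avoids4132 l :=
  fun _ x y z hs hc => h x y z ((List.sublist_cons_self _ _).trans hs) ⟨hc.1, hc.2.1⟩

lemma avoids231_cons {f : ℕ} {r : List ℕ} :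
    Avoids231 (f :: r) ↔ Avoids231 r ∧ ∀ y z, [y, z] <+ r → ¬ (z < f ∧ f < y) := by
  unfold Avoids231
  simp only [cons_sublist_cons_iff]
  grind

lemma avoids4132_cons {f : ℕ} {r : List ℕ} : Avoids4132 (f :: r) ↔
    Avoids4132 r ∧ ∀ x y z, [x, y, z] <+ r → ¬ (x < z ∧ z < y ∧ y < f) := by
  unfold Avoids4132
  simp only [cons_sublist_cons_iff]
  grind

/-- An initial segment of a sublist that lies in `S`, the rest in `T`. -/
lemma exists_of_sublist_append {u S T : List ℕ} (h : u <+ S ++ T) :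
    ∃ u₁ u₂, u = u₁ ++ u₂ ∧ u₁ <+ S ∧ u₂ <+ T := List.sublist_append_iff.1 h

lemma avoids231_append {S T : List ℕ} (hST : ∀ x ∈ S, ∀ y ∈ T, x < y) (hS : Avoids231 S)
    (hT : Avoids231 T) : Avoids231 (S ++ T) := by
  rintro x y z h ⟨h1, h2⟩
  obtain ⟨u₁, u₂, e, s1, s2⟩ := exists_of_sublist_append h
  match u₁, e with
  | [], e => exact hT x y z (by rw [e]; simpa using s2) ⟨h1, h2⟩
  | [a], e =>
    simp at e
    have := hST x (s1.subset (by simp [e])) z (s2.subset (by simp [← e.2]))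
    omega
  | [a, b], e =>
    simp at e
    have := hST x (s1.subset (by simp [e])) z (s2.subset (by simp [← e.2.2]))
    omega
  | a :: b :: c :: l, e =>
    simp at e
    exact hS x y z (by simpa [e] using s1) ⟨h1, h2⟩

lemma avoids4132_append {S T : List ℕ} (hST : ∀ x ∈ S, ∀ y ∈ T, x < y) (hS : Avoids4132 S)
    (hT : Avoids4132 T) : Avoids4132 (S ++ T) := by
  rintro w x y z h ⟨h1, h2, h3⟩
  obtain ⟨u₁, u₂, e, s1, s2⟩ := exists_of_sublist_append h
  have hlast : w ∈ u₁ → z ∈ u₂ → False := fun hw hz => by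
    have := hST w (s1.subset hw) z (s2.subset hz)
    omega
  match u₁, e with
  | [], e => exact hT w x y z (by rw [e]; simpa using s2) ⟨h1, h2, h3⟩
  | [a], e => simp at e; exact hlast (by simp [e]) (by simp [← e.2])
  | [a, b], e => simp at e; exact hlast (by simp [e]) (by simp [← e.2.2])
  | [a, b, c], e => simp at e; exact hlast (by simp [e]) (by simp [← e.2.2.2])
  | a :: b :: c :: d :: l, e =>
    simp at e
    exact hS w x y z (by simpa [e] using s1) ⟨h1, h2, h3⟩

/-- In a 231-avoiding word the letters below the first one precede those above it. -/
lemma Avoids231.exists_split {f : ℕ} {r : List ℕ} (h : Avoids231 (f :: r)) (hf : f ∉ r) :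
    ∃ S T, r = S ++ T ∧ (∀ x ∈ S, x < f) ∧ ∀ x ∈ T, f < x := by
  induction r with
  | nil => exact ⟨[], [], by simp⟩
  | cons x r ih =>
    have hx : x ≠ f := by rintro rfl; simp at hf
    have hr : f ∉ r := fun h => hf (by simp [h])
    rcases lt_or_gt_of_ne hx with hlt | hgt
    · obtain ⟨S, T, rfl, hS, hT⟩ := ih (h.sublist ((List.sublist_cons_self _ _).cons_cons _)) hr
      refine ⟨x :: S, T, by simp, ?_, hT⟩
      simpa [hlt] using hS
    · refine ⟨[], x :: r, by simp, by simp, ?_⟩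
      intro z hz
      rcases List.mem_cons.1 hz with rfl | hz
      · exact hgt
      · have h1 := h f x z (((List.singleton_sublist.2 hz).cons_cons x).cons_cons f)
        have h2 : z ≠ f := by rintro rfl; exact hr hz
        omega

/-! ### Valleys -/

/-- The words on `{a, …, a + s - 1}` that decrease and then increase and whose scan, from a large
previous letter, leaves `c` additional letters on the stack; built by adding the largest letter. -/
def valley (a : ℕ) : ℕ → ℕ → Finset (List ℕ)
  | 0, _ => ∅
  | s + 1, c => (if s = 0 ∧ c = 0 then {[a]} else ∅) ∪
      ((if c = 0 then ∅ else (valley a s (c - 1)).image (List.cons (a + s))) ∪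
        (valley a s (c + 1)).image (· ++ [a + s]))

lemma mem_valley_succ {a s c : ℕ} {S : List ℕ} : S ∈ valley a (s + 1) c ↔
    (s = 0 ∧ c = 0 ∧ S = [a]) ∨ (c ≠ 0 ∧ ∃ S' ∈ valley a s (c - 1), (a + s) :: S' = S) ∨
      ∃ S' ∈ valley a s (c + 1), S' ++ [a + s] = S := by
  rw [valley]
  simp only [Finset.mem_union, Finset.mem_image]
  split_ifs <;> simp <;> grind

lemma perm_cons_range' (a s : ℕ) : (List.range' a (s + 1)).Perm ((a + s) :: List.range' a s) := by
  rw [List.range'_concat, Nat.one_mul]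
  exact List.perm_append_singleton (a + s) _

lemma valley_perm {a s : ℕ} : ∀ {c : ℕ} {S : List ℕ}, S ∈ valley a s c →
    S.Perm (List.range' a s) := by
  induction s with
  | zero => simp [valley]
  | succ s ih =>
    intro c S h
    rcases mem_valley_succ.1 h with ⟨rfl, rfl, rfl⟩ | ⟨_, S', h1, rfl⟩ | ⟨S', h1, rfl⟩
    · simp
    · exact ((ih h1).cons _).trans (perm_cons_range' a s).symm
    · exact (List.perm_append_singleton _ _).trans
        (((ih h1).cons _).trans (perm_cons_range' a s).symm)

lemma mem_of_mem_valley {a s c x : ℕ} {S : List ℕ} (h : S ∈ valley a s c) :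
    x ∈ S ↔ a ≤ x ∧ x < a + s := by
  rw [(valley_perm h).mem_iff, List.mem_range'_1]

lemma length_of_mem_valley {a s c : ℕ} {S : List ℕ} (h : S ∈ valley a s c) : S.length = s := by
  rw [(valley_perm h).length_eq, List.length_range']

lemma lt_of_mem_valley {a s : ℕ} : ∀ {c : ℕ} {S : List ℕ}, S ∈ valley a s c → c < s := by
  induction s with
  | zero => simp [valley]
  | succ s ih =>
    intro c S h
    rcases mem_valley_succ.1 h with ⟨rfl, rfl, rfl⟩ | ⟨_, S', h1, rfl⟩ | ⟨S', h1, rfl⟩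
    · simp
    · have := ih h1; omega
    · have := ih h1; omega

lemma cons_ne_append_valley {a s c c' : ℕ} {S S' : List ℕ} (h : S ∈ valley a s c)
    (h' : S' ∈ valley a s c') : (a + s) :: S ≠ S' ++ [a + s] := by
  intro e
  cases S' with
  | nil => have := length_of_mem_valley h'; subst this; simp [valley] at h
  | cons x S' =>
    simp at e
    have := (mem_of_mem_valley h' (x := a + s)).1 (by simp [e.1])
    omega

/-- The position of the largest letter reveals the last construction step, so `c` is a function of
the word. The count needs this for disjointness. -/
lemma valley_index_unique {a s : ℕ} : ∀ {c c' : ℕ} {S : List ℕ}, S ∈ valley a s c →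
    S ∈ valley a s c' → c = c' := by
  induction s with
  | zero => simp [valley]
  | succ s ih =>
    intro c c' S h h'
    rcases mem_valley_succ.1 h with ⟨rfl, rfl, rfl⟩ | ⟨hc, S₁, h1, rfl⟩ | ⟨S₁, h1, rfl⟩ <;>
    rcases mem_valley_succ.1 h' with ⟨h2, h3, h4⟩ | ⟨hc', S₂, h2, h3⟩ | ⟨S₂, h2, h3⟩
    · exact h3.symm
    · simp [valley] at h2
    · simp [valley] at h2
    · subst h2; simp [valley] at h1
    · simp at h3; subst h3; have := ih h1 h2; omega
    · exact (cons_ne_append_valley h1 h2 h3.symm).elim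
    · subst h2; simp [valley] at h1
    · exact (cons_ne_append_valley h2 h1 h3).elim
    · simp at h3; subst h3; have := ih h1 h2; omega

/-- In 231 and 132 the largest letter is in the middle, so a new maximum at either end creates
neither pattern. -/
lemma avoids_of_mem_valley {a s : ℕ} : ∀ {c : ℕ} {S : List ℕ}, S ∈ valley a s c →
    Avoids231 S ∧ Avoids132 S := by
  induction s with
  | zero => simp [valley]
  | succ s ih =>
    intro c S h
    rcases mem_valley_succ.1 h with ⟨rfl, rfl, rfl⟩ | ⟨_, S', h1, rfl⟩ | ⟨S', h1, rfl⟩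
    · constructor <;> intro x y z h <;> simp at h
    · have hm := fun x => (mem_of_mem_valley h1 (x := x)).1
      obtain ⟨i1, i2⟩ := ih h1
      constructor
      · refine avoids231_cons.2 ⟨i1, fun y z hs hc => ?_⟩
        have := hm y (hs.subset (by simp))
        omega
      · intro x y z hs hc
        rcases cons_sublist_cons_iff.1 hs with hs' | ⟨rfl, hs'⟩
        · exact i2 x y z hs' hc
        · have := hm z (hs'.subset (by simp))
          omega
    · have hm := fun x => (mem_of_mem_valley h1 (x := x)).1
      obtain ⟨i1, i2⟩ := ih h1
      have key : ∀ x y z, [x, y, z] <+ S' ++ [a + s] →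
          [x, y, z] <+ S' ∨ (z = a + s ∧ x ∈ S' ∧ y ∈ S') := by
        intro x y z hs
        have hs := hs.reverse
        simp only [List.reverse_append, List.reverse_cons, List.reverse_nil, List.nil_append,
          List.cons_append] at hs
        rcases cons_sublist_cons_iff.1 hs with hs' | ⟨rfl, hs'⟩
        · left; simpa using hs'.reverse
        · exact Or.inr ⟨rfl, by simpa using hs'.subset (a := x) (by simp),
            by simpa using hs'.subset (a := y) (by simp)⟩
      constructor
      · intro x y z hs hc
        rcases key x y z hs with hs | ⟨rfl, hx, hy⟩
        · exact i1 x y z hs hc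
        · have := hm x hx; omega
      · intro x y z hs hc
        rcases key x y z hs with hs | ⟨rfl, hx, hy⟩
        · exact i2 x y z hs hc
        · have := hm y hy; omega

/-- Scanning a valley pushes the previous letter and `c` more letters. -/
lemma scan_valley {a s : ℕ} : ∀ {c : ℕ} {S : List ℕ}, S ∈ valley a s c →
    ∃ q L, q < a + s ∧ L.length = c ∧ (∀ t ∈ L, t < a + s) ∧
      ∀ p st T, a + s ≤ p → (Scan p st (S ++ T) ↔ Scan q (L ++ p :: st) T) := by
  induction s with
  | zero => simp [valley]
  | succ s ih =>
    intro c S h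
    rcases mem_valley_succ.1 h with ⟨rfl, rfl, rfl⟩ | ⟨hc, S', h1, rfl⟩ | ⟨S', h1, rfl⟩
    · refine ⟨a, [], by simp, rfl, by simp, fun p st T hp => ?_⟩
      rw [List.singleton_append, scan_cons_of_lt (by omega)]; simp
    · obtain ⟨q, L, hq, hl, hL, hs⟩ := ih h1
      refine ⟨q, L ++ [a + s], by omega, by simp; omega, ?_, fun p st T hp => ?_⟩
      · intro t ht
        rcases List.mem_append.1 ht with ht | ht
        · have := hL t ht; omega
        · simp at ht; omega
      · rw [List.cons_append, scan_cons_of_lt (by omega), hs _ _ _ le_rfl]; simp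
    · obtain ⟨q, L, hq, hl, hL, hs⟩ := ih h1
      cases L with
      | nil => simp at hl
      | cons t L =>
        refine ⟨a + s, L, by omega, by simpa using hl, ?_, fun p st T hp => ?_⟩
        · intro x hx
          have := hL x (by simp [hx]); omega
        · rw [List.append_assoc, hs _ _ _ (by omega), List.singleton_append, List.cons_append,
            scan_cons_cons hq.le]
          simp [hL t]

/-- A maximum with letters on both sides is the middle of a 231 or a 132. Hence it is first or last,
as in the recursion of `valley`; the scan serves to exclude an index dropping below 0. -/
lemma mem_valley_of_scan {a s : ℕ} : ∀ {S : List ℕ}, S.Perm (List.range' a (s + 1)) →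
    Avoids231 S → Avoids132 S → ∀ p st T, a + s < p → Scan p st (S ++ T) →
      ∃ c, S ∈ valley a (s + 1) c := by
  induction s with
  | zero =>
    intro S hS _ _ p st T _ _
    have : S = [a] := by simpa using hS
    exact ⟨0, mem_valley_succ.2 (by simp [this])⟩
  | succ s ih =>
    intro S hS h1 h2 p st T hp hT
    have hmem : a + (s + 1) ∈ S := by rw [hS.mem_iff, List.mem_range'_1]; omega
    obtain ⟨X, Y, rfl⟩ := List.append_of_mem hmem
    have hXY := ((List.perm_middle.symm.trans hS).trans (perm_cons_range' a (s + 1))).cons_inv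
    have hm : ∀ x ∈ X ++ Y, a ≤ x ∧ x < a + (s + 1) := fun x hx => by
      rw [hXY.mem_iff, List.mem_range'_1] at hx; exact hx
    cases X with
    | nil =>
      simp only [List.nil_append, List.cons_append] at *
      rw [scan_cons_of_lt hp] at hT
      obtain ⟨c, hc⟩ := ih hXY (h1.sublist (List.sublist_cons_self _ _))
        (h2.sublist (List.sublist_cons_self _ _)) _ _ T (by omega) hT
      exact ⟨c + 1, mem_valley_succ.2 (Or.inr (Or.inl ⟨by simp, Y, hc, rfl⟩))⟩
    | cons x X =>
      cases Y with
      | nil =>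
        simp only [List.append_nil] at hXY
        rw [List.append_assoc] at hT
        obtain ⟨c, hc⟩ := ih hXY (h1.sublist (List.sublist_append_left _ _))
          (h2.sublist (List.sublist_append_left _ _)) _ _ _ (by omega) hT
        cases c with
        | zero =>
          -- With no letter of the valley left on the stack, the final ascent would have to pop `p`,
          -- which is larger.
          obtain ⟨q, L, hq, hl, hL, hs⟩ := scan_valley hc
          rw [hs _ _ _ (by omega), List.length_eq_zero_iff.1 hl, List.nil_append,
            List.singleton_append, scan_cons_cons (by omega)] at hT
          omega
        | succ c => exact ⟨c, mem_valley_succ.2 (Or.inr (Or.inr ⟨_, hc, rfl⟩))⟩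
      | cons y Y =>
        have hsub : [x, a + (s + 1), y] <+ x :: X ++ (a + (s + 1)) :: y :: Y :=
          (((List.nil_sublist Y).cons_cons y).cons_cons (a + (s + 1))).trans
            (List.sublist_append_right X _) |>.cons_cons x
        have h3 := h1 _ _ _ hsub
        have h4 := h2 _ _ _ hsub
        have h5 := hm x (by simp)
        have h6 := hm y (by simp)
        have h7 : x ≠ y := by
          rintro rfl
          have := hXY.nodup_iff.2 List.nodup_range'
          simp [List.nodup_append] at this
        omega

/-! ### The words avoiding 231 and 4132 that are accepted by the scan -/

/-- The words on `{a, …, a + n - 1}` avoiding 231 and 4132 that the scan accepts from a stack of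
`h` small letters; built by splitting off the first letter and the valley below it. -/
def words : ℕ → ℕ → ℕ → Finset (List ℕ)
  | 0, _, h => if h = 0 then {[]} else ∅
  | n + 1, a, h => if h = 0 then ∅ else (words n (a + 1) (h - 1)).image (List.cons a) ∪
      (Finset.univ : Finset (Fin n)).biUnion fun i => (Finset.range n).biUnion fun c =>
        (valley a (i + 1) c ×ˢ words (n - (i + 1)) (a + i + 2) (h + c)).image
          fun P => (a + i + 1) :: (P.1 ++ P.2)

lemma mem_words_succ {n a h : ℕ} {w : List ℕ} : w ∈ words (n + 1) a (h + 1) ↔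
    (∃ T ∈ words n (a + 1) h, a :: T = w) ∨ ∃ i < n, ∃ c, ∃ S ∈ valley a (i + 1) c,
      ∃ T ∈ words (n - (i + 1)) (a + i + 2) (h + 1 + c), (a + i + 1) :: (S ++ T) = w := by
  rw [words]
  simp only [Nat.add_eq_zero_iff, one_ne_zero, and_false, if_false, Finset.mem_union,
    Finset.mem_image, Finset.mem_biUnion, Finset.mem_univ, true_and, Finset.mem_range,
    Finset.mem_product, Prod.exists, Nat.add_sub_cancel]
  refine or_congr Iff.rfl ⟨?_, ?_⟩
  · rintro ⟨i, c, hc, S, T, ⟨hS, hT⟩, rfl⟩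
    exact ⟨i, i.2, c, S, hS, T, hT, rfl⟩
  · rintro ⟨i, hi, c, S, hS, T, hT, rfl⟩
    have := lt_of_mem_valley hS
    exact ⟨⟨i, hi⟩, c, by omega, S, T, ⟨hS, hT⟩, rfl⟩

lemma scan_nil {p : ℕ} {st : List ℕ} : Scan p st [] ↔ st = [] := by rw [Scan.eq_def]

lemma perm_range'_of_mem_iff {l : List ℕ} {a n : ℕ} (hl : l.Nodup)
    (h : ∀ x, x ∈ l ↔ a ≤ x ∧ x < a + n) : l.Perm (List.range' a n) :=
  (List.perm_ext_iff_of_nodup hl List.nodup_range').2 fun x => by rw [h, List.mem_range'_1]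

/-- The previous letter and the stack lie below `a`, so every comparison with them succeeds and only
the stack size counts. A first letter above `a` is followed by a valley on the letters below it:
231-avoidance puts those letters first, and 4132-avoidance with the first letter as 4 makes them
avoid 132. -/
theorem mem_words_iff (n : ℕ) : ∀ (a p : ℕ) (st : List ℕ) (w : List ℕ), p < a →
    (∀ t ∈ st, t < a) → (w ∈ words n a st.length ↔ w.Perm (List.range' a n) ∧ Avoids231 w ∧
      Avoids4132 w ∧ Scan p st w) := by
  induction n using Nat.strong_induction_on with
  | _ n ih =>
    intro a p st w hp hst
    cases n with
    | zero =>
      rw [words]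
      simp only [List.range'_zero, List.perm_nil]
      constructor
      · intro h
        split_ifs at h with h0
        · simp at h
          subst h
          refine ⟨rfl, ?_, ?_, ?_⟩
          · intro x y z h; simpa using h.length_le
          · intro w x y z h; simpa using h.length_le
          · rw [scan_nil]; simpa using h0
        · simp at h
      · rintro ⟨rfl, _, _, h⟩
        rw [scan_nil] at h
        simp [h]
    | succ n =>
      cases st with
      | nil =>
        simp only [List.length_nil, words, if_true, Finset.notMem_empty, false_iff, not_and]
        intro hw _ _
        cases w with
        | nil => simpa using hw.length_eq
        | cons f r =>
          have := (List.mem_range'_1.1 (hw.mem_iff.1 (List.mem_cons_self (a := f)))).1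
          exact scan_cons_nil (by omega)
      | cons t st =>
        rw [List.length_cons, mem_words_succ]
        have ht : t < a := hst t (by simp)
        have hst' : ∀ x ∈ st, x < a := fun x hx => hst x (by simp [hx])
        constructor
        · rintro (⟨T, hT, rfl⟩ | ⟨i, hi, c, S, hS, T, hT, rfl⟩)
          · rw [ih n (by omega) (a + 1) a st T (by omega)
              (fun x hx => by have := hst' x hx; omega)] at hT
            obtain ⟨h1, h2, h3, h4⟩ := hT
            have hm : ∀ x ∈ T, a + 1 ≤ x ∧ x < a + 1 + n := fun x hx => by
              rwa [h1.mem_iff, List.mem_range'_1] at hx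
            refine ⟨?_, ?_, ?_, ?_⟩
            · rw [List.range'_succ]; exact h1.cons a
            · refine avoids231_cons.2 ⟨h2, fun y z hs hc => ?_⟩
              have := hm z (hs.subset (by simp)); omega
            · refine avoids4132_cons.2 ⟨h3, fun x y z hs hc => ?_⟩
              have := hm y (hs.subset (by simp)); omega
            · rw [scan_cons_cons hp.le]; exact ⟨ht, h4⟩
          · obtain ⟨q, L, hq, hl, hL, hs⟩ := scan_valley hS
            -- The first letter pops `t`; the valley then pushes that letter and `c` more.
            have hlen : (L ++ (a + i + 1) :: st).length = st.length + 1 + c := by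
              simp; omega
            rw [← hlen, ih (n - (i + 1)) (by omega) (a + i + 2) q _ T (by omega) ?_] at hT
            swap
            · intro x hx
              rcases List.mem_append.1 hx with hx | hx
              · have := hL x hx; omega
              · rcases List.mem_cons.1 hx with rfl | hx
                · omega
                · have := hst' x hx; omega
            obtain ⟨h1, h2, h3, h4⟩ := hT
            have hmT : ∀ x, x ∈ T ↔ a + i + 2 ≤ x ∧ x < a + n + 1 := fun x => by
              rw [h1.mem_iff, List.mem_range'_1]; omega
            have hmS := fun x => mem_of_mem_valley hS (x := x)
            have hST : ∀ x ∈ S, ∀ y ∈ T, x < y := fun x hx y hy => by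
              have := (hmS x).1 hx; have := (hmT y).1 hy; omega
            obtain ⟨v1, v2⟩ := avoids_of_mem_valley hS
            refine ⟨?_, ?_, ?_, ?_⟩
            · apply perm_range'_of_mem_iff
              · rw [List.nodup_cons, List.nodup_append]
                refine ⟨?_, (valley_perm hS).nodup_iff.2 List.nodup_range',
                  h1.nodup_iff.2 List.nodup_range', fun x hx y hy => (hST x hx y hy).ne⟩
                rw [List.mem_append, hmS, hmT]; omega
              · intro x
                rw [List.mem_cons, List.mem_append, hmS, hmT]; omega
            · refine avoids231_cons.2 ⟨avoids231_append hST v1 h2, fun y z hs hc => ?_⟩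
              obtain ⟨u₁, u₂, e, s1, s2⟩ := exists_of_sublist_append hs
              match u₁, e with
              | [], e =>
                have := (hmT z).1 (s2.subset (by simp at e; simp [← e])); omega
              | b :: l, e =>
                simp at e
                have := (hmS y).1 (s1.subset (by simp [e])); omega
            · refine avoids4132_cons.2
                ⟨avoids4132_append hST v2.avoids4132 h3, fun x y z hs hc => ?_⟩
              have hT' : ∀ x ∈ T, a + i + 1 < x := fun x hx => by
                have := (hmT x).1 hx; omega
              obtain ⟨u₁, u₂, e, s1, s2⟩ := exists_of_sublist_append hs
              -- The last letter of the pattern is below the first letter of the word, so it lies in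
              -- `S`, and with it the letters before it.
              have hz : z ∉ u₂ := fun h => by have := hT' z (s2.subset h); omega
              match u₁, e with
              | [], e => simp at e; simp [← e] at hz
              | [b], e => simp at e; simp [← e.2] at hz
              | [b, d], e => simp at e; simp [← e.2.2] at hz
              | b :: d :: g :: l, e =>
                simp at e
                exact v2 x y z (by simpa [e] using s1) ⟨hc.1, hc.2.1⟩
            · rw [scan_cons_cons (by omega), hs _ _ _ (by omega)]
              exact ⟨by omega, h4⟩
        · rintro ⟨hw, h2, h3, h4⟩
          cases w with
          | nil => simpa using hw.length_eq
          | cons f r =>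
            have hd : (f :: r).Nodup := hw.nodup_iff.2 List.nodup_range'
            have hm : ∀ x, x ∈ f :: r ↔ a ≤ x ∧ x < a + (n + 1) := fun x => by
              rw [hw.mem_iff, List.mem_range'_1]
            have hf := (hm f).1 (by simp)
            rw [scan_cons_cons (by omega)] at h4
            have hfr := (List.nodup_cons.1 hd).1
            obtain ⟨S, T, rfl, hS, hT⟩ := h2.exists_split hfr
            have hdST := (List.nodup_cons.1 hd).2
            have h2' := h2.sublist (List.sublist_cons_self _ _)
            have h3' := h3.sublist (List.sublist_cons_self _ _)
            have T2 := h2'.sublist (List.sublist_append_right S T)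
            have T3 := h3'.sublist (List.sublist_append_right S T)
            have hmS : ∀ x, x ∈ S ↔ a ≤ x ∧ x < f := by
              intro x
              have := hm x
              simp only [List.mem_cons, List.mem_append] at this
              constructor
              · intro h; exact ⟨(this.1 (by simp [h])).1, hS x h⟩
              · rintro ⟨h, h'⟩
                rcases this.2 (by omega) with h6 | h6 | h6
                · omega
                · exact h6
                · have := hT x h6; omega
            have hmT : ∀ x, x ∈ T ↔ f < x ∧ x < a + (n + 1) := by
              intro x
              have := hm x
              simp only [List.mem_cons, List.mem_append] at this
              constructor
              · intro h; exact ⟨hT x h, (this.1 (by simp [h])).2⟩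
              · rintro ⟨h, h'⟩
                rcases this.2 (by omega) with h6 | h6 | h6
                · omega
                · have := hS x h6; omega
                · exact h6
            obtain ⟨dS, dT, -⟩ := List.nodup_append.1 hdST
            rcases Nat.eq_or_lt_of_le hf.1 with rfl | hlt
            · left
              have hS0 : S = [] := by
                rw [List.eq_nil_iff_forall_not_mem]
                intro x hx
                have := (hmS x).1 hx; omega
              subst hS0
              refine ⟨T, ?_, rfl⟩
              rw [ih n (by omega) (a + 1) a st T (by omega)
                (fun x hx => by have := hst' x hx; omega)]
              exact ⟨perm_range'_of_mem_iff dT fun x => by rw [hmT]; omega, T2, T3, h4.2⟩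
            · right
              obtain ⟨i, rfl⟩ : ∃ i, f = a + i + 1 := ⟨f - a - 1, by omega⟩
              have pS : S.Perm (List.range' a (i + 1)) :=
                perm_range'_of_mem_iff dS fun x => by rw [hmS]; omega
              have S132 : Avoids132 S := by
                intro x y z hs hc
                refine h3 (a + i + 1) x y z
                  ((hs.trans (List.sublist_append_left S T)).cons_cons _) ⟨hc.1, hc.2, ?_⟩
                exact ((hmS y).1 (hs.subset (by simp))).2
              obtain ⟨c, hc⟩ := mem_valley_of_scan pS
                (h2'.sublist (List.sublist_append_left S T)) S132 _ _ _ (by omega) h4.2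
              obtain ⟨q, L, hq, hl, hL, hs⟩ := scan_valley hc
              have hlen : (L ++ (a + i + 1) :: st).length = st.length + 1 + c := by
                simp; omega
              refine ⟨i, by omega, c, S, hc, T, ?_, rfl⟩
              rw [← hlen, ih (n - (i + 1)) (by omega) (a + i + 2) q _ T (by omega) ?_]
              · refine ⟨perm_range'_of_mem_iff dT fun x => by rw [hmT]; omega, T2, T3, ?_⟩
                rw [← hs _ _ _ (by omega)]
                exact h4.2
              · intro x hx
                rcases List.mem_append.1 hx with hx | hx
                · have := hL x hx; omega
                · rcases List.mem_cons.1 hx with rfl | hx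
                  · omega
                  · have := hst' x hx; omega

theorem uniquelySortedAvoiding_eq_words (k : ℕ) :
    uniquelySortedAvoiding (2 * k + 1) {[2, 3, 1], [4, 1, 3, 2]} = ↑(words (2 * k + 1) 1 1) := by
  ext w
  have h := mem_words_iff (2 * k + 1) 1 0 [0] w (by simp) (by simp)
  rw [List.length_singleton] at h
  rw [Finset.mem_coe, h]
  unfold uniquelySortedAvoiding permWords
  simp only [Set.mem_ofPred_eq, Set.mem_insert_iff, Set.mem_singleton_iff, forall_eq_or_imp,
    forall_eq, not_contains_231_iff, not_contains_4132_iff]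
  constructor
  · rintro ⟨h1, h2, h3, h4⟩
    refine ⟨h1, h3, h4, ?_⟩
    rwa [fertility_eq_one_iff_scan] at h2
    · exact ⟨h1.nodup_iff.2 List.nodup_range', fun x hx => by
        rw [h1.mem_iff, List.mem_range'_1] at hx; omega⟩
    · rintro rfl; simpa using h1.length_eq
  · rintro ⟨h1, h3, h4, h2⟩
    refine ⟨h1, ?_, h3, h4⟩
    rwa [fertility_eq_one_iff_scan]
    · exact ⟨h1.nodup_iff.2 List.nodup_range', fun x hx => by
        rw [h1.mem_iff, List.mem_range'_1] at hx; omega⟩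
    · rintro rfl; simpa using h1.length_eq

end UniquelySorted

namespace UniquelySorted
open PowerSeries

/-! ### Generating functions -/

lemma catalanGF_eq : catalanGF = 1 + X * catalanGF ^ 2 := by
  have h := congrArg (PowerSeries.map (Nat.castRingHom ℤ)) catalanSeries_sq_mul_X_add_one
  have e : PowerSeries.map (Nat.castRingHom ℤ) catalanSeries = catalanGF := by
    ext n; simp [catalanGF]
  simp only [map_add, map_mul, map_pow, e, map_one, PowerSeries.map_X] at h
  linear_combination -h

/-- The power series `C(x C(x))`. -/
noncomputable def pairGF : PowerSeries ℤ := (catalanGF.subst (X * catalanGF : PowerSeries ℤ))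

lemma pairGF_eq : pairGF = 1 + X * catalanGF * pairGF ^ 2 := by
  have hs : HasSubst (X * catalanGF : PowerSeries ℤ) :=
    HasSubst.of_constantCoeff_zero' (by simp)
  have h := congrArg (substAlgHom hs) catalanGF_eq
  simp only [map_add, map_mul, map_pow, map_one, substAlgHom_X, coe_substAlgHom] at h
  exact h

/-- A power series is determined by `f = 1 + x C(x) f²`. -/
lemma eq_pairGF {f : PowerSeries ℤ} (hf : f = 1 + X * catalanGF * f ^ 2) : f = pairGF := by
  have h := pairGF_eq
  have h1 : (f - pairGF) * (1 - X * (catalanGF * (f + pairGF))) = 0 := by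
    linear_combination hf - h
  rcases mul_eq_zero.1 h1 with h2 | h2
  · exact sub_eq_zero.1 h2
  · have := congrArg constantCoeff h2
    simp at this

/-- `C(z²)`. -/
noncomputable def catalanSq : PowerSeries ℤ := expand 2 two_ne_zero catalanGF

/-- `z U(z²)`, where `U(x) = C(x C(x))`. -/
noncomputable def wordGF : PowerSeries ℤ := X * expand 2 two_ne_zero pairGF

lemma catalanSq_eq : catalanSq = 1 + X ^ 2 * catalanSq ^ 2 := by
  have h := congrArg (expand 2 two_ne_zero) catalanGF_eq
  simp only [map_add, map_mul, map_pow, map_one, expand_X] at h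
  exact h

lemma wordGF_eq : wordGF = X + X * catalanSq * wordGF ^ 2 := by
  have h := congrArg (expand 2 two_ne_zero) pairGF_eq
  simp only [map_add, map_mul, map_pow, map_one, expand_X] at h
  unfold wordGF catalanSq
  linear_combination X * h

lemma coeff_wordGF (k : ℕ) : coeff (2 * k + 1) wordGF = coeff k pairGF := by
  rw [wordGF, coeff_succ_X_mul, coeff_expand_mul]

/-! ### Counting valleys and words -/

lemma card_valley (a s : ℕ) : ∀ c, ((valley a s c).card : ℤ) =
    coeff s ((X * catalanSq) ^ (c + 1)) := by
  induction s with
  | zero => intro c; simp [valley]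
  | succ s ih =>
    intro c
    have inj1 : Function.Injective (List.cons (a + s)) := fun x y h => by simpa using h
    have inj2 : Function.Injective (fun S : List ℕ => S ++ [a + s]) := fun x y h => by
      simpa using h
    have d1 : Disjoint (if c = 0 then ∅ else (valley a s (c - 1)).image (List.cons (a + s)))
        ((valley a s (c + 1)).image (· ++ [a + s])) := by
      rw [Finset.disjoint_left]
      intro S h h'
      split_ifs at h with h0
      · simp at h
      · obtain ⟨S₁, h1, rfl⟩ := Finset.mem_image.1 h
        obtain ⟨S₂, h2, h3⟩ := Finset.mem_image.1 h'
        exact cons_ne_append_valley h1 h2 h3.symm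
    have d2 : Disjoint (if s = 0 ∧ c = 0 then {[a]} else ∅)
        ((if c = 0 then ∅ else (valley a s (c - 1)).image (List.cons (a + s))) ∪
        (valley a s (c + 1)).image (· ++ [a + s])) := by
      split_ifs with h1 h2
      · rw [h1.1]; simp [valley]
      · exact (h2 h1.2).elim
      · simp
      · simp
    rw [valley, Finset.card_union_of_disjoint d2, Finset.card_union_of_disjoint d1,
      Finset.card_image_of_injective _ inj2]
    -- For `V = X * catalanSq` this is `V = z + z V²` times `V^c`. The term `V^c` stands for
    -- prepending the maximum (for `c = 0`, for the one-letter valley), `V^(c+2)` for appending it.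
    have key : (X * catalanSq) ^ (c + 1) =
        X * ((X * catalanSq) ^ c + (X * catalanSq) ^ (c + 2)) := by
      linear_combination X * (X * catalanSq) ^ c * catalanSq_eq
    rw [key, coeff_succ_X_mul, map_add]
    push_cast
    rw [ih (c + 1)]
    cases c with
    | zero =>
      simp [coeff_one]
      split_ifs <;> simp
    | succ c =>
      simp only [Nat.add_eq_zero_iff, one_ne_zero, and_false, if_false, Finset.card_empty,
        Nat.cast_zero, zero_add, Nat.add_sub_cancel]
      rw [Finset.card_image_of_injective _ inj1, ih c]

/-- This is `W^(h+1) = z W^h / (1 - V W)` expanded to `K` terms; the explicit remainder avoids an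
infinite sum. -/
lemma wordGF_pow_succ (h K : ℕ) : wordGF ^ (h + 1) = X * (wordGF ^ h +
    ∑ c ∈ Finset.range K, (X * catalanSq) ^ (c + 1) * wordGF ^ (h + 1 + c)) +
      (X * catalanSq) ^ (K + 1) * wordGF ^ (h + K + 2) := by
  induction K with
  | zero =>
    simp only [Finset.range_zero, Finset.sum_empty]
    linear_combination wordGF ^ h * wordGF_eq
  | succ K ih =>
    rw [Finset.sum_range_succ]
    linear_combination ih + (X * catalanSq) ^ (K + 1) * wordGF ^ (h + K + 1) * wordGF_eq

lemma coeff_wordGF_pow_succ (h n : ℕ) : coeff (n + 1) (wordGF ^ (h + 1)) =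
    coeff n (wordGF ^ h) + ∑ i ∈ Finset.range n, ∑ c ∈ Finset.range n,
      coeff (i + 1) ((X * catalanSq) ^ (c + 1)) *
        coeff (n - (i + 1)) (wordGF ^ (h + 1 + c)) := by
  -- One factor `X` taken from `wordGF` makes the remainder divisible by `X^(n+2)`, so it does not
  -- reach the coefficient `n + 1`.
  have e : (X * catalanSq) ^ (n + 1) * wordGF ^ (h + n + 2) = X ^ (n + 2) *
      (catalanSq ^ (n + 1) * expand 2 two_ne_zero pairGF * wordGF ^ (h + n + 1)) := by
    rw [pow_succ wordGF (h + n + 1)]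
    nth_rw 2 [wordGF]
    ring
  rw [wordGF_pow_succ h n, e, map_add, coeff_X_pow_mul', if_neg (by omega), add_zero,
    coeff_succ_X_mul, map_add, map_sum, Finset.sum_comm]
  congr 1
  refine Finset.sum_congr rfl fun c _ => ?_
  rw [coeff_mul, Finset.Nat.sum_antidiagonal_eq_sum_range_succ_mk, Finset.sum_range_succ']
  simp

/-- The unions in `words` are disjoint: the first letter gives `i`, the next `i + 1` letters are the
valley, and the valley determines `c`. -/
theorem card_words (n : ℕ) : ∀ a h, ((words n a h).card : ℤ) = coeff n (wordGF ^ h) := by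
  induction n using Nat.strong_induction_on with
  | _ n ih =>
    intro a h
    cases n with
    | zero =>
      rw [words]
      split_ifs with h0
      · simp [h0]
      · simp [wordGF, h0]
    | succ n =>
      cases h with
      | zero => simp [words, coeff_one]
      | succ h =>
        have inj1 : Function.Injective (List.cons a) := fun x y h => by simpa using h
        have d1 : Disjoint ((words n (a + 1) h).image (List.cons a))
            ((Finset.univ : Finset (Fin n)).biUnion fun i => (Finset.range n).biUnion fun c =>
              (valley a (i + 1) c ×ˢ words (n - (i + 1)) (a + i + 2) (h + 1 + c)).image
                fun P => (a + i + 1) :: (P.1 ++ P.2)) := by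
          rw [Finset.disjoint_left]
          intro w h1 h2
          simp only [Finset.mem_image, Finset.mem_biUnion] at h1 h2
          obtain ⟨T, _, rfl⟩ := h1
          obtain ⟨i, _, c, _, P, _, h3⟩ := h2
          simp at h3
          omega
        rw [words, if_neg (by omega), Nat.add_sub_cancel, Finset.card_union_of_disjoint d1,
          Finset.card_image_of_injective _ inj1, Finset.card_biUnion, coeff_wordGF_pow_succ]
        · push_cast
          rw [ih n (by omega), ← Fin.sum_univ_eq_sum_range (fun i => ∑ c ∈ Finset.range n,
            coeff (i + 1) ((X * catalanSq) ^ (c + 1)) *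
              coeff (n - (i + 1)) (wordGF ^ (h + 1 + c)))]
          congr 1
          refine Finset.sum_congr rfl fun i _ => ?_
          rw [Finset.card_biUnion]
          · push_cast
            refine Finset.sum_congr rfl fun c _ => ?_
            rw [Finset.card_image_of_injOn, Finset.card_product, Nat.cast_mul, card_valley,
              ih _ (by omega)]
            rintro ⟨S, T⟩ hP ⟨S', T'⟩ hP' e
            simp only [Finset.coe_product, Set.mem_prod, Finset.mem_coe] at hP hP'
            simp only [List.cons.injEq, true_and] at e
            obtain ⟨rfl, rfl⟩ := List.append_inj e
              (by rw [length_of_mem_valley hP.1, length_of_mem_valley hP'.1])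
            rfl
          · intro c _ c' _ hne
            rw [Function.onFun, Finset.disjoint_left]
            intro w h1 h2
            simp only [Finset.mem_image, Finset.mem_product] at h1 h2
            obtain ⟨P, hP, rfl⟩ := h1
            obtain ⟨P', hP', e⟩ := h2
            simp only [List.cons.injEq, true_and] at e
            obtain ⟨e1, -⟩ := List.append_inj e
              (by rw [length_of_mem_valley hP.1, length_of_mem_valley hP'.1])
            rw [e1] at hP'
            exact hne (valley_index_unique hP.1 hP'.1)
        · intro i _ i' _ hne
          rw [Function.onFun, Finset.disjoint_left]
          intro w h1 h2
          simp only [Finset.mem_image, Finset.mem_biUnion] at h1 h2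
          obtain ⟨c, _, P, _, rfl⟩ := h1
          obtain ⟨c', _, P', _, e⟩ := h2
          simp only [List.cons.injEq] at e
          exact hne (Fin.ext (by omega))

theorem ncard_uniquelySortedAvoiding (k : ℕ) :
    ((uniquelySortedAvoiding (2 * k + 1) {[2, 3, 1], [4, 1, 3, 2]}).ncard : ℤ) =
      coeff k pairGF := by
  rw [uniquelySortedAvoiding_eq_words, Set.ncard_coe_finset, card_words, pow_one, coeff_wordGF]

end UniquelySorted

namespace UniquelySorted
open PowerSeries

/-! ### Longevities of sums and nested Dyck words -/

lemma length_downRuns (w : List DyckStep) : (downRuns w).length = w.count DyckStep.U := by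
  induction w with
  | nil => simp [downRuns]
  | cons s w ih => cases s <;> simp [downRuns, ih]

lemma downRuns_append_U (v w : List DyckStep) :
    downRuns (v ++ DyckStep.U :: w) = downRuns v ++ downRuns (DyckStep.U :: w) := by
  induction v with
  | nil => simp [downRuns]
  | cons s v ih =>
    cases s with
    | D => simpa [downRuns] using ih
    | U =>
      simp only [List.cons_append, downRuns, ih, List.cons.injEq, and_true]
      congr 1
      rw [List.takeWhile_append]
      split_ifs with h
      · simp [(List.takeWhile_prefix (· = DyckStep.D)).eq_of_length h]
      · rfl

lemma downRuns_eq_nil {v : List DyckStep} : downRuns v = [] ↔ DyckStep.U ∉ v := by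
  rw [← List.length_eq_zero_iff, length_downRuns, List.count_eq_zero]

lemma downRuns_append_D {v : List DyckStep} (hv : DyckStep.U ∈ v) :
    ∃ g x, downRuns v = g ++ [x] ∧ downRuns (v ++ [DyckStep.D]) = g ++ [x + 1] := by
  induction v with
  | nil => simp at hv
  | cons s v ih =>
    cases s with
    | D => simpa [downRuns] using ih (by simpa using hv)
    | U =>
      simp only [List.cons_append, downRuns]
      by_cases h : DyckStep.U ∈ v
      · obtain ⟨g, x, h1, h2⟩ := ih h
        refine ⟨(v.takeWhile (· = DyckStep.D)).length :: g, x, by simp [h1], ?_⟩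
        rw [h2, List.takeWhile_append, if_neg]
        · simp
        · intro h3
          have h4 := (List.takeWhile_prefix (· = DyckStep.D)).eq_of_length h3
          rw [← h4] at h
          simpa using List.mem_takeWhile_imp h
      · have h1 : ∀ y ∈ v, y = DyckStep.D := fun y hy => by
          cases y with
          | U => exact (h hy).elim
          | D => rfl
        refine ⟨[], v.length, ?_, ?_⟩
        · rw [downRuns_eq_nil.2 h, List.takeWhile_eq_self_iff.2 (by simpa using h1)]; simp
        · rw [downRuns_eq_nil.2 (by simpa using h), List.takeWhile_eq_self_iff.2]
          · simp
          · intro y hy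
            rcases List.mem_append.1 hy with hy | hy
            · simpa using h1 y hy
            · simpa using hy

lemma length_downRuns_toList (p : DyckWord) : (downRuns p.toList).length = p.semilength :=
  length_downRuns _

lemma downRuns_add (p q : DyckWord) :
    downRuns (p + q).toList = downRuns p.toList ++ downRuns q.toList := by
  have e : (p + q).toList = p.toList ++ q.toList := rfl
  rw [e]
  rcases eq_or_ne q.toList [] with h | h
  · rw [h]; simp [downRuns]
  · have hU := q.head_eq_U h
    obtain ⟨x, l, hx⟩ := List.exists_cons_of_ne_nil h
    simp only [hx, List.head_cons] at hU
    subst hU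
    rw [hx, downRuns_append_U]

/-- The number of down steps before the up step with index `m`. -/
def downsBefore (p : DyckWord) (m : ℕ) : ℕ := ((downRuns p.toList).take m).sum

lemma downRuns_nest (p : DyckWord) : (p = 0 ∧ downRuns p.nest.toList = [1]) ∨
    ∃ g x, downRuns p.toList = g ++ [x] ∧ downRuns p.nest.toList = 0 :: (g ++ [x + 1]) := by
  have e : p.nest.toList = DyckStep.U :: (p.toList ++ [DyckStep.D]) := by simp [DyckWord.nest]
  rw [e]
  rcases eq_or_ne p.toList [] with h | h
  · left
    exact ⟨DyckWord.toList_eq_nil.1 h, by rw [h]; simp [downRuns]⟩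
  · right
    have hU := p.head_eq_U h
    obtain ⟨y, l, hx⟩ := List.exists_cons_of_ne_nil h
    simp only [hx, List.head_cons] at hU
    subst hU
    obtain ⟨g, x, h1, h2⟩ := downRuns_append_D (v := p.toList) (by simp [hx])
    refine ⟨g, x, h1, ?_⟩
    rw [downRuns, h2, hx]
    simp

lemma dyck_induction {P : DyckWord → Prop} (zero : P 0)
    (add : ∀ p q : DyckWord, P p → P q → P (p.nest + q)) : ∀ p, P p := by
  suffices h : ∀ k, ∀ p : DyckWord, p.semilength = k → P p from fun p => h _ p rfl
  intro k
  induction k using Nat.strong_induction_on with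
  | _ k ih =>
    intro p hp
    rcases eq_or_ne p 0 with rfl | h
    · exact zero
    · rw [← DyckWord.nest_insidePart_add_outsidePart h]
      exact add _ _ (ih _ (hp ▸ DyckWord.semilength_insidePart_lt h) _ rfl)
        (ih _ (hp ▸ DyckWord.semilength_outsidePart_lt h) _ rfl)

lemma downsBefore_spec : ∀ p : DyckWord,
    (downRuns p.toList).sum = p.semilength ∧ ∀ m, downsBefore p m ≤ m := by
  apply dyck_induction
  · exact ⟨by simp [downRuns, DyckWord.semilength, show (0 : DyckWord).toList = [] from rfl],
      fun m => by
      simp [downsBefore, downRuns]⟩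
  · rintro p q ⟨p1, p2⟩ ⟨q1, q2⟩
    have hn : (downRuns p.nest.toList).sum = p.nest.semilength ∧
        ∀ m, downsBefore p.nest m ≤ m := by
      unfold downsBefore
      rcases downRuns_nest p with ⟨rfl, h⟩ | ⟨g, x, h1, h2⟩
      · rw [h]
        refine ⟨by simp, fun m => ?_⟩
        cases m <;> simp
      · have hl := length_downRuns_toList p
        unfold downsBefore at p2
        rw [h1] at p1 p2 hl
        rw [h2, DyckWord.semilength_nest, ← p1]
        refine ⟨by simp; omega, fun m => ?_⟩
        cases m with
        | zero => simp
        | succ m =>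
          have := p2 m
          simp only [List.take_succ_cons, List.sum_cons, zero_add, List.take_append,
            List.sum_append, List.length_append, List.length_singleton]
            at this p1 hl ⊢
          rcases Nat.lt_or_ge g.length m with hm | hm
          · rw [List.take_of_length_le hm.le, List.take_of_length_le (by simp; omega)] at this ⊢
            simp at this ⊢
            omega
          · have : m - g.length = 0 := by omega
            simp_all
            omega
    obtain ⟨n1, n2⟩ := hn
    unfold downsBefore at n2 q2 ⊢
    rw [downRuns_add, DyckWord.semilength_add, ← n1, ← q1]
    refine ⟨List.sum_append, fun m => ?_⟩
    rw [List.take_append, List.sum_append, length_downRuns_toList]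
    rcases Nat.lt_or_ge p.nest.semilength m with hm | hm
    · rw [List.take_of_length_le (by rw [length_downRuns_toList]; exact hm.le)]
      have := q2 (m - p.nest.semilength)
      omega
    · have := n2 m
      rw [Nat.sub_eq_zero_of_le hm]
      simpa using this

lemma downsBefore_le (p : DyckWord) (m : ℕ) : downsBefore p m ≤ m := (downsBefore_spec p).2 m

lemma downsBefore_of_le {p : DyckWord} {m : ℕ} (h : p.semilength ≤ m) :
    downsBefore p m = p.semilength := by
  rw [downsBefore, List.take_of_length_le (by rwa [length_downRuns_toList]),
    (downsBefore_spec p).1]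

lemma downsBefore_add_left (p q : DyckWord) {m : ℕ} (h : m ≤ p.semilength) :
    downsBefore (p + q) m = downsBefore p m := by
  unfold downsBefore
  rw [downRuns_add, List.take_append, length_downRuns_toList, Nat.sub_eq_zero_of_le h]
  simp

lemma downsBefore_add_right (p q : DyckWord) (m : ℕ) :
    downsBefore (p + q) (p.semilength + m) = p.semilength + downsBefore q m := by
  unfold downsBefore
  rw [downRuns_add, List.take_append, List.take_of_length_le (by simp [length_downRuns_toList]),
    List.sum_append, (downsBefore_spec p).1, length_downRuns_toList, Nat.add_sub_cancel_left]

lemma downsBefore_nest_succ (p : DyckWord) {m : ℕ} (h : m < p.semilength) :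
    downsBefore p.nest (m + 1) = downsBefore p m := by
  unfold downsBefore
  rcases downRuns_nest p with ⟨rfl, _⟩ | ⟨g, x, h1, h2⟩
  · simp at h
  · have hl := length_downRuns_toList p
    rw [h1] at hl ⊢
    rw [h2]
    simp at hl
    simp [List.take_append, show m - g.length = 0 by omega]

lemma sum_getD_eq (l : List ℕ) (m : ℕ) :
    ∑ i ∈ Finset.range m, l.getD i 0 = (l.take m).sum := by
  induction l generalizing m with
  | nil => simp
  | cons a l ih =>
    cases m with
    | zero => simp
    | succ m => rw [Finset.sum_range_succ']; simp [← ih, add_comm]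

/-- Prefix sums of the down runs transform simply under sums and nesting of Dyck words, and all
longevity computations go through them. -/
lemma longevity_eq (p : DyckWord) (j : ℕ) :
    longevity p j = sInf {t | downsBefore p j + t < downsBefore p (j + t + 1)} := by
  unfold longevity
  congr 1
  ext t
  have h := Finset.sum_range_add (fun i => (downRuns p.toList).getD i 0) j (t + 1)
  rw [sum_getD_eq, sum_getD_eq] at h
  simp only [Set.mem_ofPred_eq]
  unfold downsBefore
  rw [add_assoc j t 1, h]
  omega

lemma longevity_eq_of {p : DyckWord} {j t : ℕ} (h : downsBefore p j + t < downsBefore p (j + t + 1))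
    (h' : ∀ u < t, downsBefore p (j + u + 1) ≤ downsBefore p j + u) : longevity p j = t := by
  rw [longevity_eq]
  apply le_antisymm
  · exact Nat.sInf_le h
  · refine le_csInf ⟨t, h⟩ fun u hu => ?_
    by_contra! hlt
    have := h' u hlt
    have : downsBefore p j + u < downsBefore p (j + u + 1) := hu
    omega

lemma longevity_spec {p : DyckWord} {j : ℕ} (hj : j < p.semilength) :
    j + longevity p j < p.semilength ∧
      downsBefore p j + longevity p j < downsBefore p (j + longevity p j + 1) ∧
      ∀ u < longevity p j, downsBefore p (j + u + 1) ≤ downsBefore p j + u := by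
  -- Taking all remaining runs always suffices: at most `j` of the down steps precede the up step
  -- `j`.
  have hT : p.semilength - 1 - j ∈
      {t | downsBefore p j + t < downsBefore p (j + t + 1)} := by
    rw [Set.mem_ofPred_eq, downsBefore_of_le (m := _ + _) (by omega)]
    have := downsBefore_le p j
    omega
  rw [longevity_eq]
  refine ⟨?_, Nat.sInf_mem ⟨_, hT⟩, fun u hu => ?_⟩
  · have := Nat.sInf_le hT
    omega
  · have := Nat.notMem_of_lt_sInf hu
    rw [Set.mem_ofPred_eq] at this
    omega

lemma longevity_lt {p : DyckWord} {j : ℕ} (hj : j < p.semilength) :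
    j + longevity p j < p.semilength := (longevity_spec hj).1

lemma longevity_add_left {p : DyckWord} (q : DyckWord) {j : ℕ} (hj : j < p.semilength) :
    longevity (p + q) j = longevity p j := by
  obtain ⟨h1, h2, h3⟩ := longevity_spec hj
  apply longevity_eq_of
  · rwa [downsBefore_add_left _ _ (by omega), downsBefore_add_left _ _ (by omega)]
  · intro u hu
    rw [downsBefore_add_left _ _ (by omega), downsBefore_add_left _ _ (by omega)]
    exact h3 u hu

lemma longevity_add_right (p q : DyckWord) (j : ℕ) :
    longevity (p + q) (p.semilength + j) = longevity q j := by
  rw [longevity_eq, longevity_eq]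
  congr 1
  ext t
  simp only [Set.mem_ofPred_eq]
  rw [add_assoc, add_assoc, downsBefore_add_right, downsBefore_add_right, add_assoc, add_assoc]
  omega

lemma longevity_nest_zero (p : DyckWord) : longevity p.nest 0 = p.semilength := by
  have h0 : downsBefore p.nest 0 = 0 := by simp [downsBefore]
  apply longevity_eq_of
  · rw [h0, downsBefore_of_le (by simp)]; simp
  · intro u hu
    simp only [h0, zero_add]
    rw [downsBefore_nest_succ _ hu]
    exact downsBefore_le p u

lemma longevity_nest_succ {p : DyckWord} {j : ℕ} (hj : j < p.semilength) :
    longevity p.nest (j + 1) = longevity p j := by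
  obtain ⟨h1, h2, h3⟩ := longevity_spec hj
  apply longevity_eq_of
  · rw [downsBefore_nest_succ _ hj]
    rcases Nat.lt_or_ge (j + longevity p j + 1) p.semilength with h | h
    · rw [show j + 1 + longevity p j + 1 = j + longevity p j + 1 + 1 by omega,
        downsBefore_nest_succ _ h]
      exact h2
    · rw [downsBefore_of_le (p := p.nest) (by simp; omega)]
      rw [downsBefore_of_le h] at h2
      simp; omega
  · intro u hu
    rw [downsBefore_nest_succ _ hj, show j + 1 + u + 1 = j + u + 1 + 1 by omega,
        downsBefore_nest_succ _ (by omega)]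
    exact h3 u hu

lemma longevity_cons_zero (p q : DyckWord) : longevity (p.nest + q) 0 = p.semilength := by
  rw [longevity_add_left _ (by simp), longevity_nest_zero]

lemma longevity_cons_succ {p : DyckWord} (q : DyckWord) {j : ℕ} (hj : j < p.semilength) :
    longevity (p.nest + q) (j + 1) = longevity p j := by
  rw [longevity_add_left _ (by simpa using hj), longevity_nest_succ hj]

lemma longevity_cons_add (p q : DyckWord) (j : ℕ) :
    longevity (p.nest + q) (p.semilength + 1 + j) = longevity q j := by
  rw [← DyckWord.semilength_nest, longevity_add_right]

lemma semilength_eq_zero {p : DyckWord} : p.semilength = 0 ↔ p = 0 := by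
  constructor
  · intro h
    by_contra h'
    have := DyckWord.semilength_insidePart_add_semilength_outsidePart_add_one h'
    omega
  · rintro rfl; rfl

lemma exists_eq_nest_add {p : DyckWord} (h : 0 < p.semilength) : ∃ a b : DyckWord, p = a.nest + b := by
  have h' : p ≠ 0 := by rintro rfl; simp at h
  exact ⟨_, _, (DyckWord.nest_insidePart_add_outsidePart h').symm⟩

/-- A Dyck word splits at index `i` if no up step before `i` reaches beyond `i`. -/
lemma exists_add_of_longevity : ∀ (p : DyckWord) (i : ℕ), i ≤ p.semilength →
    (∀ j < i, j + longevity p j < i) → ∃ u v, p = u + v ∧ u.semilength = i := by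
  apply dyck_induction
  · intro i hi _
    exact ⟨0, 0, by simp, (Nat.le_zero.1 hi).symm⟩
  · intro a b _ ihb i hi h
    rcases Nat.eq_zero_or_pos i with rfl | h0
    · exact ⟨0, a.nest + b, by simp, rfl⟩
    · have h1 := h 0 h0
      rw [longevity_cons_zero] at h1
      simp at hi
      obtain ⟨u, v, rfl, hu⟩ := ihb (i - (a.semilength + 1)) (by omega) (fun j hj => by
        have := h (a.semilength + 1 + j) (by omega)
        rw [longevity_cons_add] at this
        omega)
      exact ⟨a.nest + u, v, by rw [add_assoc], by simp; omega⟩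

/-- The longevity of the first up step is the semilength under the first arch; this locates the
first return, and induction handles both parts. -/
lemma eq_of_longevity_eq : ∀ (p q : DyckWord), p.semilength = q.semilength →
    (∀ j < p.semilength, longevity p j = longevity q j) → p = q := by
  apply dyck_induction (P := fun p => ∀ q : DyckWord, p.semilength = q.semilength →
    (∀ j < p.semilength, longevity p j = longevity q j) → p = q)
  · intro q h _
    exact (semilength_eq_zero.1 h.symm).symm
  · intro a b iha ihb q h hl
    obtain ⟨a', b', rfl⟩ := exists_eq_nest_add (p := q) (by rw [← h]; simp)
    have h0 := hl 0 (by simp)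
    rw [longevity_cons_zero, longevity_cons_zero] at h0
    simp at h hl
    rw [iha a' h0 fun j hj => ?_, ihb b' (by omega) fun j hj => ?_]
    · have := hl (a.semilength + 1 + j) (by omega)
      rwa [longevity_cons_add, h0, longevity_cons_add] at this
    · have := hl (j + 1) (by omega)
      rwa [longevity_cons_succ _ hj, longevity_cons_succ _ (by omega)] at this

/-! ### The Pallo comb order -/

/-- The order of the Pallo comb posets on Dyck words. -/
def PalloRel (p q : DyckWord) : Prop :=
  p.semilength = q.semilength ∧ (∀ j < p.semilength, longevity p j ≤ longevity q j) ∧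
    ∀ j < p.semilength, longevity p j < longevity q j → ∀ l < j, l + longevity p l < j

/-- For `l < j` the truncated subtraction in `PalloLE` is exact. -/
lemma palloLE_iff {k : ℕ} (p q : DyckPath k) : PalloLE p q ↔ PalloRel p.1 q.1 := by
  obtain ⟨p, rfl⟩ := p
  obtain ⟨q, hq⟩ := q
  unfold PalloLE TamariLE PalloRel
  simp only [hq.symm, true_and]
  refine and_congr_right fun _ => forall₂_congr fun j hj => imp_congr_right fun _ =>
    forall₂_congr fun l hl => ?_
  omega

/-- Builds an interval from a Dyck word and two intervals. -/
def glue (x : DyckWord × (DyckWord × DyckWord) × (DyckWord × DyckWord)) : DyckWord × DyckWord :=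
  (x.1.nest + (x.2.1.1 + x.2.2.1), (x.1 + x.2.1.2).nest + x.2.2.2)

/-- Every index below `A + 1 + B + C` lies in one of four consecutive ranges. -/
lemma index_cases (A B C j : ℕ) (hj : j < A + 1 + (B + C)) : j = 0 ∨ (∃ i < A, j = i + 1) ∨
    (∃ i < B, j = A + 1 + i) ∨ ∃ i < C, j = A + 1 + (B + i) := by
  rcases Nat.lt_or_ge j 1 with h | h
  · left; omega
  rcases Nat.lt_or_ge j (A + 1) with h1 | h1
  · right; left; exact ⟨j - 1, by omega, by omega⟩
  rcases Nat.lt_or_ge j (A + 1 + B) with h2 | h2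
  · right; right; left; exact ⟨j - (A + 1), by omega, by omega⟩
  · right; right; right; exact ⟨j - (A + 1 + B), by omega, by omega⟩

section glue

variable (a b c b' c' : DyckWord)

lemma longevity_glue_fst_b {i : ℕ} (hi : i < b.semilength) :
    longevity (a.nest + (b + c)) (a.semilength + 1 + i) = longevity b i := by
  rw [longevity_cons_add, longevity_add_left _ hi]

lemma longevity_glue_fst_c (i : ℕ) :
    longevity (a.nest + (b + c)) (a.semilength + 1 + (b.semilength + i)) = longevity c i := by
  rw [longevity_cons_add, longevity_add_right]

lemma longevity_glue_snd_zero :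
    longevity ((a + b').nest + c') 0 = a.semilength + b'.semilength := by
  rw [longevity_cons_zero, DyckWord.semilength_add]

lemma longevity_glue_snd_a {i : ℕ} (hi : i < a.semilength) :
    longevity ((a + b').nest + c') (i + 1) = longevity a i := by
  rw [longevity_cons_succ _ (by simp; omega), longevity_add_left _ hi]

lemma longevity_glue_snd_b {i : ℕ} (hi : i < b'.semilength) :
    longevity ((a + b').nest + c') (a.semilength + 1 + i) = longevity b' i := by
  rw [show a.semilength + 1 + i = a.semilength + i + 1 by omega,
    longevity_cons_succ _ (by simp; omega), longevity_add_right]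

lemma longevity_glue_snd_c (i : ℕ) :
    longevity ((a + b').nest + c') (a.semilength + 1 + (b'.semilength + i)) = longevity c' i := by
  rw [← longevity_cons_add (a + b') c', DyckWord.semilength_add]
  congr 1
  omega

end glue

/-- Longevity increases at index 0, which has no predecessor, and possibly inside `b` and `c`. There
the arches of earlier summands are already closed, and earlier steps of the same summand are covered
by the given relation. -/
lemma palloRel_glue {a b c b' c' : DyckWord} (hb : PalloRel b b') (hc : PalloRel c c') :
    PalloRel (a.nest + (b + c)) ((a + b').nest + c') := by
  obtain ⟨b1, b2, b3⟩ := hb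
  obtain ⟨c1, c2, c3⟩ := hc
  have hlen : (a.nest + (b + c)).semilength =
      a.semilength + 1 + (b.semilength + c.semilength) := by simp
  unfold PalloRel
  rw [hlen]
  refine ⟨by simp; omega, ?_, ?_⟩
  · intro j hj
    rcases index_cases _ _ _ _ hj with rfl | ⟨i, hi, rfl⟩ | ⟨i, hi, rfl⟩ | ⟨i, hi, rfl⟩
    · rw [longevity_cons_zero, longevity_glue_snd_zero]; omega
    · rw [longevity_cons_succ _ hi, longevity_glue_snd_a _ _ _ hi]
    · rw [longevity_glue_fst_b _ _ _ hi, longevity_glue_snd_b _ _ _ (by omega)]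
      exact b2 i hi
    · rw [longevity_glue_fst_c, b1, longevity_glue_snd_c]
      exact c2 i hi
  · intro j hj hlt l hl
    rcases index_cases _ _ _ _ hj with rfl | ⟨i, hi, rfl⟩ | ⟨i, hi, rfl⟩ | ⟨i, hi, rfl⟩
    · omega
    · rw [longevity_cons_succ _ hi, longevity_glue_snd_a _ _ _ hi] at hlt
      omega
    · rw [longevity_glue_fst_b _ _ _ hi, longevity_glue_snd_b _ _ _ (by omega)] at hlt
      rcases index_cases _ _ _ _ (hl.trans hj) with rfl | ⟨m, hm, rfl⟩ | ⟨m, hm, rfl⟩ |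
        ⟨m, hm, rfl⟩
      · rw [longevity_cons_zero]; omega
      · rw [longevity_cons_succ _ hm]
        have := longevity_lt hm
        omega
      · rw [longevity_glue_fst_b _ _ _ hm]
        have := b3 i hi hlt m (by omega)
        omega
      · omega
    · rw [longevity_glue_fst_c, b1, longevity_glue_snd_c] at hlt
      rcases index_cases _ _ _ _ (hl.trans hj) with rfl | ⟨m, hm, rfl⟩ | ⟨m, hm, rfl⟩ |
        ⟨m, hm, rfl⟩
      · rw [longevity_cons_zero]; omega
      · rw [longevity_cons_succ _ hm]
        have := longevity_lt hm
        omega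
      · rw [longevity_glue_fst_b _ _ _ hm]
        have := longevity_lt hm
        omega
      · rw [longevity_glue_fst_c]
        have := c3 i hi hlt m (by omega)
        omega

lemma PalloRel.exists_glue {p q : DyckWord} (h : PalloRel p q) (h0 : 0 < p.semilength) :
    ∃ a b c b' c', p = a.nest + (b + c) ∧ q = (a + b').nest + c' ∧ PalloRel b b' ∧
      PalloRel c c' := by
  obtain ⟨h1, h2, h3⟩ := h
  obtain ⟨a, p₂, rfl⟩ := exists_eq_nest_add h0
  obtain ⟨q₁, c', rfl⟩ := exists_eq_nest_add (h1 ▸ h0)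
  have hle := h2 0 h0
  rw [longevity_cons_zero, longevity_cons_zero] at hle
  simp only [DyckWord.semilength_add, DyckWord.semilength_nest] at h1 h2 h3
  -- An increase under the first arch of `p` would require, at `l = 0`, that this arch end earlier.
  have hlon : ∀ j < a.semilength, longevity q₁ j = longevity a j := by
    intro j hj
    have g2 := h2 (j + 1) (by omega)
    have g3 := h3 (j + 1) (by omega)
    rw [longevity_cons_succ _ hj, longevity_cons_succ _ (by omega)] at g2 g3
    by_contra hne
    have := g3 (by omega) 0 (by omega)
    rw [longevity_cons_zero] at this
    omega
  obtain ⟨u, b', rfl, hu⟩ := exists_add_of_longevity q₁ a.semilength hle (fun j hj => by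
    rw [hlon j hj]; exact longevity_lt hj)
  obtain rfl : u = a := eq_of_longevity_eq u a hu fun j hj => by
    rw [← hlon j (by omega), longevity_add_left _ hj]
  rw [DyckWord.semilength_add] at h1
  -- Longevities in `p` are at most those in `q`, where arches of `b'` stay inside `b'`; so `p₂`
  -- splits at that length.
  obtain ⟨b, c, rfl, hb⟩ := exists_add_of_longevity p₂ b'.semilength (by omega) (fun j hj => by
    have g2 := h2 (u.semilength + 1 + j) (by omega)
    rw [longevity_cons_add, longevity_glue_snd_b _ _ _ hj] at g2
    have := longevity_lt hj
    omega)
  rw [DyckWord.semilength_add] at h1 h2 h3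
  refine ⟨u, b, c, b', c', rfl, rfl, ⟨hb, fun j hj => ?_, fun j hj hlt l hl => ?_⟩,
    ⟨by omega, fun j hj => ?_, fun j hj hlt l hl => ?_⟩⟩
  · have g2 := h2 (u.semilength + 1 + j) (by omega)
    rwa [longevity_glue_fst_b _ _ _ hj, longevity_glue_snd_b _ _ _ (by omega)] at g2
  · have g3 := h3 (u.semilength + 1 + j) (by omega)
    rw [longevity_glue_fst_b _ _ _ hj, longevity_glue_snd_b _ _ _ (by omega)] at g3
    have := g3 hlt (u.semilength + 1 + l) (by omega)
    rw [longevity_glue_fst_b _ _ _ (by omega)] at this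
    omega
  · have g2 := h2 (u.semilength + 1 + (b.semilength + j)) (by omega)
    rwa [longevity_glue_fst_c, hb, longevity_glue_snd_c] at g2
  · have g3 := h3 (u.semilength + 1 + (b.semilength + j)) (by omega)
    rw [longevity_glue_fst_c, hb, longevity_glue_snd_c, ← hb] at g3
    have := g3 hlt (u.semilength + 1 + (b.semilength + l)) (by omega)
    rw [longevity_glue_fst_c] at this
    omega

/-! ### Injectivity of the gluing and the number of intervals -/

lemma nest_add_inj {a a' b b' : DyckWord} (h : a.nest + b = a'.nest + b') : a = a' ∧ b = b' := by
  constructor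
  · have := congrArg DyckWord.insidePart h
    rwa [DyckWord.insidePart_add (by simp), DyckWord.insidePart_add (by simp),
      DyckWord.insidePart_nest, DyckWord.insidePart_nest] at this
  · have := congrArg DyckWord.outsidePart h
    rwa [DyckWord.outsidePart_add (by simp), DyckWord.outsidePart_add (by simp),
      DyckWord.outsidePart_nest, DyckWord.outsidePart_nest, zero_add, zero_add] at this

lemma add_inj_of_semilength {b c b' c' : DyckWord} (h : b + c = b' + c')
    (hl : b.semilength = b'.semilength) : b = b' ∧ c = c' := by
  have e : b.toList ++ c.toList = b'.toList ++ c'.toList := congrArg DyckWord.toList h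
  obtain ⟨e1, e2⟩ := List.append_inj e (by
    rw [← DyckWord.two_mul_semilength_eq_length, ← DyckWord.two_mul_semilength_eq_length, hl])
  exact ⟨DyckWord.ext e1, DyckWord.ext e2⟩

/-- The Dyck words of semilength `k`. -/
def dyckWords (k : ℕ) : Finset DyckWord :=
  (Finset.univ : Finset {p : DyckWord // p.semilength = k}).map (Function.Embedding.subtype _)

lemma mem_dyckWords {k : ℕ} {p : DyckWord} : p ∈ dyckWords k ↔ p.semilength = k := by
  simp [dyckWords]

lemma card_dyckWords (k : ℕ) : (dyckWords k).card = catalan k := by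
  rw [dyckWords, Finset.card_map, Finset.card_univ, DyckWord.card_dyckWord_semilength_eq_catalan]

open Classical in
/-- The intervals of the `k`-th Pallo comb poset. -/
noncomputable def intervals (k : ℕ) : Finset (DyckWord × DyckWord) :=
  (dyckWords k ×ˢ dyckWords k).filter fun x => PalloRel x.1 x.2

lemma mem_intervals {k : ℕ} {x : DyckWord × DyckWord} :
    x ∈ intervals k ↔ x.1.semilength = k ∧ PalloRel x.1 x.2 := by
  simp only [intervals, Finset.mem_filter, Finset.mem_product, mem_dyckWords]
  exact ⟨fun h => ⟨h.1.1, h.2⟩, fun h => ⟨⟨h.1, h.2.1 ▸ h.1⟩, h.2⟩⟩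

lemma card_palloInterval (k : ℕ) : Nat.card (PalloInterval k) = (intervals k).card := by
  rw [← Nat.card_eq_finsetCard]
  refine Nat.card_congr
    { toFun := fun I => ⟨(I.1.1.1, I.1.2.1), mem_intervals.2 ⟨I.1.1.2, (palloLE_iff _ _).1 I.2⟩⟩
      invFun := fun x => ⟨(⟨x.1.1, (mem_intervals.1 x.2).1⟩, ⟨x.1.2,
        (mem_intervals.1 x.2).2.1 ▸ (mem_intervals.1 x.2).1⟩),
        (palloLE_iff _ _).2 (mem_intervals.1 x.2).2⟩
      left_inv := fun _ => rfl
      right_inv := fun _ => rfl }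

lemma intervals_succ (k : ℕ) : intervals (k + 1) = ((Finset.HasAntidiagonal.antidiagonal k).biUnion fun x =>
    (Finset.HasAntidiagonal.antidiagonal x.2).biUnion fun y =>
      dyckWords x.1 ×ˢ intervals y.1 ×ˢ intervals y.2).image glue := by
  ext ⟨p, q⟩
  simp only [Finset.mem_image, Finset.mem_biUnion, Finset.mem_product, Finset.HasAntidiagonal.mem_antidiagonal,
    mem_intervals, mem_dyckWords, Prod.exists]
  constructor
  · rintro ⟨h1, h2⟩
    obtain ⟨a, b, c, b', c', rfl, rfl, hb, hc⟩ := h2.exists_glue (by omega)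
    simp at h1
    exact ⟨a, b, b', c, c', ⟨a.semilength, b.semilength + c.semilength, by omega, b.semilength,
      c.semilength, rfl, rfl, ⟨rfl, hb⟩, rfl, hc⟩, rfl⟩
  · rintro ⟨a, b, b', c, c', ⟨i, m, h, i', m', h', ha, ⟨hb, hb'⟩, hc, hc'⟩, e⟩
    simp only [glue, Prod.mk.injEq] at e
    obtain ⟨rfl, rfl⟩ := e
    exact ⟨by simp; omega, palloRel_glue hb' hc'⟩

/-- `glue` is injective on the triples counted: first returns recover `a`, `b + c`, `a + b'` and
`c'`; cancelling `a` gives `b'`, and `b` has the same semilength as `b'`, which fixes the cut in `b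
+ c`. -/
lemma card_intervals_succ (k : ℕ) : (intervals (k + 1)).card =
    ∑ x ∈ Finset.HasAntidiagonal.antidiagonal k, catalan x.1 * ∑ y ∈ Finset.HasAntidiagonal.antidiagonal x.2,
      (intervals y.1).card * (intervals y.2).card := by
  rw [intervals_succ, Finset.card_image_of_injOn, Finset.card_biUnion]
  · refine Finset.sum_congr rfl fun x _ => ?_
    rw [Finset.card_biUnion, Finset.mul_sum]
    · refine Finset.sum_congr rfl fun y _ => ?_
      rw [Finset.card_product, Finset.card_product, card_dyckWords]
    · intro y _ y' _ hne
      rw [Function.onFun, Finset.disjoint_left]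
      rintro ⟨a, b, c⟩ h h'
      simp only [Finset.mem_product, mem_intervals] at h h'
      exact hne (Prod.ext (h.2.1.1.symm.trans h'.2.1.1) (h.2.2.1.symm.trans h'.2.2.1))
  · intro x hx x' hx' hne
    rw [Function.onFun, Finset.disjoint_left]
    rintro ⟨a, b, c⟩ h h'
    simp only [Finset.mem_biUnion, Finset.mem_product, mem_dyckWords] at h h'
    obtain ⟨_, _, h, _⟩ := h
    obtain ⟨_, _, h', _⟩ := h'
    simp only [Finset.mem_coe, Finset.HasAntidiagonal.mem_antidiagonal] at hx hx'
    have : x.1 = x'.1 := h.symm.trans h'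
    exact hne (Prod.ext this (by omega))
  · rintro ⟨a, ⟨b, b'⟩, c, c'⟩ h ⟨a₁, ⟨b₁, b₁'⟩, c₁, c₁'⟩ h₁ e
    simp only [Finset.coe_biUnion, Set.mem_iUnion, Finset.mem_coe, Finset.mem_product,
      mem_intervals] at h h₁
    obtain ⟨_, _, _, _, _, ⟨_, hb, _⟩, _⟩ := h
    obtain ⟨_, _, _, _, _, ⟨_, hb₁, _⟩, _⟩ := h₁
    simp only [glue, Prod.mk.injEq] at e
    obtain ⟨e1, e2⟩ := nest_add_inj e.1
    obtain ⟨e3, e4⟩ := nest_add_inj e.2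
    subst e1
    have e5 : b' = b₁' := add_left_cancel e3
    obtain ⟨e6, e7⟩ := add_inj_of_semilength e2 (by
      change b.semilength = b'.semilength at hb
      change b₁.semilength = b₁'.semilength at hb₁
      rw [hb, hb₁, e5])
    simp_all

lemma card_intervals (k : ℕ) : ((intervals k).card : ℤ) = coeff k pairGF := by
  have h : (PowerSeries.mk fun k => ((intervals k).card : ℤ)) = pairGF := by
    apply eq_pairGF
    ext k
    cases k with
    | zero =>
      have : intervals 0 = {(0, 0)} := by
        ext ⟨p, q⟩
        simp only [mem_intervals, Finset.mem_singleton, Prod.mk.injEq, semilength_eq_zero]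
        constructor
        · rintro ⟨rfl, h, -⟩
          exact ⟨rfl, semilength_eq_zero.1 h.symm⟩
        · rintro ⟨rfl, rfl⟩
          exact ⟨rfl, rfl, by simp⟩
      simp [this]
    | succ k =>
      rw [map_add, mul_assoc, coeff_succ_X_mul, coeff_mul, coeff_mk, card_intervals_succ]
      simp [coeff_one, sq, coeff_mul, catalanGF]
  rw [← h, coeff_mk]

end UniquelySorted

theorem theorem6 :
    (PowerSeries.mk fun k : ℕ =>
        ((UniquelySorted.uniquelySortedAvoiding (2 * k + 1) {[2, 3, 1], [4, 1, 3, 2]}).ncard : ℤ)) =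
      PowerSeries.subst (PowerSeries.X * UniquelySorted.catalanGF : PowerSeries ℤ)
        UniquelySorted.catalanGF ∧
    ∀ k : ℕ,
      (UniquelySorted.uniquelySortedAvoiding (2 * k + 1) {[2, 3, 1], [4, 1, 3, 2]}).ncard =
        Nat.card (UniquelySorted.PalloInterval k) := by
  refine ⟨?_, fun k => ?_⟩
  · ext k
    rw [PowerSeries.coeff_mk, UniquelySorted.ncard_uniquelySortedAvoiding]
    rfl
  · rw [UniquelySorted.card_palloInterval, ← Nat.cast_inj (R := ℤ),
      UniquelySorted.ncard_uniquelySortedAvoiding, UniquelySorted.card_intervals]
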